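/- **Setting.** Let $\mathbf k$ be a commutative ring. Operads are symmetric operads in $\mathbf k$-modules; $[n]=\{1,\dots,n\}$. *Configurations.* A *configuration* $\mathcal C=(C_n)_{n\ge1}$ is a sequence of sets $C_n$ of nonempty subsets of $[n]$ such that for every $J\in C_n$, every reduced planar rooted tree $\tau$ with $n$ leaves numbered from left to right (every vertex has at least two inputs) and every vertex $\omega$ of $\tau$ with $\ell$ inputs, the set $J\sqcap\omega\subseteq[\ell]$ of those inputs of $\omega$ whose branch contains a leaf in $J$ is either empty or an element of $C_\ell$. It is *$\mathbb S$-invariant* if $I\in C_n$ and $\sigma\in\mathbb S_n$ imply $\sigma(I)\in C_n$. *Operads.* Let $\mathcal P=\mathcal T(V)/(R)$ be presented by an $\mathbb S$-module $V$ of generators in arities $\ge 2$ (the identity is the operadic unit and is not counted as a generator) and a set $R$ of homogeneous relations $r=\sum_i c_i\tau_i$, where $c_i\in\mathbf k$ and the $\tau_i$ are reduced planar trees with vertices decorated by elements of $V$ and with leaves labelled bijectively by $[n]$, for some $n\ge 1$ depending on $r$. Here $\mathcal T(-)$ is the free operad and $(-)$ the generated operadic ideal. *Splitting.* Let $\mathcal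 C$ be an $\mathbb S$-invariant configuration. Let $\mathcal C\mathrm{Sp}(V)(n)=V(n)\otimes\bigoplus_{I\in C_n}\mathbf k e_I$, with $\sigma$ acting by $\binom{\omega}{e_I}\mapsto\binom{\sigma\omega}{e_{\sigma(I)}}$, where $\binom{\omega}{e_I}=\omega\otimes e_I$ and $\sigma\omega$ is $\omega$ with its input $i$ renamed to $\sigma(i)$. For a decorated tree $\tau$ and $J\in C_n$, let $\mathcal C\mathrm{Sp}_J(\tau)$ be obtained from $\tau$ by replacing the decoration $\omega\in V(\ell)$ of each vertex by $\binom{\omega}{e_{J\sqcap\omega}}$ if $J\sqcap\omega\ne\emptyset$ and by $\sum_{I\in C_\ell}\binom{\omega}{e_I}$ if $J\sqcap\omega=\emptyset$, and extend this linearly to relations. The $\mathcal C$-splitting of $\mathcal P$ is $$\mathcal C\mathrm{Sp}(\mathcal P)=\mathcal T(\mathcal C\mathrm{Sp}(V))\big/\big(\mathcal C\mathrm{Sp}_J(r)\;:\; r\in R\text{ with leaf labels }[n],\ J\in C_n\big).$$ *Rota–Baxter operators (of weight one).* Let $V_P=V\oplus\mathbf k P$ with $P$ a new generator of arity $1$,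 and for $\omega\in V(n)$, $I\subseteq[n]$ let $\omega\circ P^{\otimes n,I}$ be the composite of $\omega$ with $\mathrm{id}$ at the inputs in $I$ and with $P$ at all other inputs ($P^{\otimes n}=P^{\otimes n,\emptyset}$). The operad of $\mathcal C$-Rota–Baxter $\mathcal P$-algebras is $$\mathcal C\mathrm{RB}(\mathcal P)=\mathcal T(V_P)\Big/\Big(R,\ \ \omega\circ P^{\otimes n}-\sum_{I\in C_n}P\circ\omega\circ P^{\otimes n,I}\;:\;\omega\in V(n)\Big).$$ A *$\mathcal C$-Rota–Baxter operator* on a $\mathcal P$-algebra $A$ is a linear map $P:A\to A$ with $\omega(Px_1,\dots,Px_n)=P\big(\sum_{I\in C_n}\omega(P^{\otimes,I}(x_1,\dots,x_n))\big)$ for all $n$, $\omega\in V(n)$ and $x_1,\dots,x_n\in A$, where $P^{\otimes,I}(x_1,\dots,x_n)$ has $i$-th entry $x_i$ if $i\in I$ and $P(x_i)$ if $i\notin I$. Let $\xi:\mathcal T(\mathcal C\mathrm{Sp}(V))\to\mathcal T(V_P)$ be the morphism of operads with $\xi\binom{\omega}{e_I}=\omega\circ P^{\otimes n,I}$ for $\omega\in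 V(n)$, $I\in C_n$. **Theorem.** Let $\mathcal P=\mathcal T(V)/(R)$ be an operad as above and $\mathcal C$ an $\mathbb S$-invariant configuration. 1. $\xi$ induces a (unique) morphism of operads $\mathcal C\mathrm{Sp}(\mathcal P)\to\mathcal C\mathrm{RB}(\mathcal P)$, that is, one that commutes with $\xi$ and the two projections from the free operads. 2. Let $A$ be a $\mathcal P$-algebra and $P:A\to A$ a $\mathcal C$-Rota–Baxter operator. Then the operations $$\binom{\omega}{e_I}(x_1,\dots,x_n):=\omega\big(P^{\otimes,I}(x_1,\dots,x_n)\big),\qquad \omega\in V(n),\ I\in C_n,\ x_1,\dots,x_n\in A,$$ make $A$ into a $\mathcal C\mathrm{Sp}(\mathcal P)$-algebra (in a unique way). -/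

import Mathlib

/-! Algebraic (symmetric, `k`-linear) operads, free operads, operads presented by generators and
relations, splittings of operads along a configuration, and Rota-Baxter operators on operads. -/

universe u v w x

noncomputable section

namespace OperadSplitting

/-! ### `S`-modules and operads -/

/-- An `S`-module: a sequence of `k`-modules `V(n)` with linear actions of the symmetric groups.
`σ` renames input `i` to input `σ i`, which is a left action (`ω^σ` is `act n σ ω`). -/
structure SModule (k : Type u) [CommRing k] where
  obj : ℕ → Type v
  [addCommGroup : ∀ n, AddCommGroup (obj n)]
  [module : ∀ n, Module k (obj n)]
  act : ∀ n, Representation k (Equiv.Perm (Fin n)) (obj n)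

attribute [instance] SModule.addCommGroup SModule.module

/-- A symmetric operad in `k`-modules. The composite `comp m e μ ν` is `μ ∘ (ν₁ ⊗ ⋯ ⊗ ν_ℓ)`, with
its inputs numbered by `e`: the `j`-th input of `ν i` is input number `e ⟨i, j⟩` of the composite.
(The usual composite `γ(μ; ν₁, …, ν_ℓ)` is the case where `e` is the lexicographic numbering, and
every other numbering is obtained from it by the action of a permutation: see `act_comp`.) -/
structure SOperad (k : Type u) [CommRing k] extends SModule.{u, v} k where
  one : obj 1
  comp : ∀ {ℓ n : ℕ} (m : Fin ℓ → ℕ), ((Σ i, Fin (m i)) ≃ Fin n) →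
    (obj ℓ →ₗ[k] MultilinearMap k (fun i => obj (m i)) (obj n))
  act_comp : ∀ {ℓ n : ℕ} (m : Fin ℓ → ℕ) (e : (Σ i, Fin (m i)) ≃ Fin n)
    (σ : Equiv.Perm (Fin n)) (μ : obj ℓ) (ν : ∀ i, obj (m i)),
    act n σ (comp m e μ ν) = comp m (e.trans σ) μ ν
  comp_act_left : ∀ {ℓ n : ℕ} (m : Fin ℓ → ℕ) (e : (Σ i, Fin (m i)) ≃ Fin n)
    (σ : Equiv.Perm (Fin ℓ)) (e' : (Σ i, Fin (m (σ i))) ≃ Fin n)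
    (μ : obj ℓ) (ν : ∀ i, obj (m i)),
    (∀ i j, e' ⟨i, j⟩ = e ⟨σ i, j⟩) →
    comp m e (act ℓ σ μ) ν = comp (fun i => m (σ i)) e' μ (fun i => ν (σ i))
  comp_act_right : ∀ {ℓ n : ℕ} (m : Fin ℓ → ℕ) (e e' : (Σ i, Fin (m i)) ≃ Fin n)
    (s : ∀ i, Equiv.Perm (Fin (m i))) (μ : obj ℓ) (ν : ∀ i, obj (m i)),
    (∀ i j, e' ⟨i, j⟩ = e ⟨i, s i j⟩) →
    comp m e μ (fun i => act (m i) (s i) (ν i)) = comp m e' μ ν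
  comp_one : ∀ {n : ℕ} (e : (Σ _ : Fin n, Fin 1) ≃ Fin n) (σ : Equiv.Perm (Fin n)) (μ : obj n),
    (∀ i, e ⟨i, 0⟩ = σ i) → comp (fun _ => 1) e μ (fun _ => one) = act n σ μ
  one_comp : ∀ {n : ℕ} (e : (Σ _ : Fin 1, Fin n) ≃ Fin n) (σ : Equiv.Perm (Fin n)) (ν : obj n),
    (∀ j, e ⟨0, j⟩ = σ j) → comp (fun _ => n) e one (fun _ => ν) = act n σ ν
  assoc : ∀ {ℓ n N : ℕ} (m : Fin ℓ → ℕ) (f : (Σ i, Fin (m i)) ≃ Fin n)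
    (p : Fin n → ℕ) (e : (Σ x, Fin (p x)) ≃ Fin N)
    (q : Fin ℓ → ℕ) (h : ∀ i, (Σ j, Fin (p (f ⟨i, j⟩))) ≃ Fin (q i))
    (g : (Σ i, Fin (q i)) ≃ Fin N)
    (μ : obj ℓ) (ν : ∀ i, obj (m i)) (ρ : ∀ x, obj (p x)),
    (∀ i j l, e ⟨f ⟨i, j⟩, l⟩ = g ⟨i, h i ⟨j, l⟩⟩) →
    comp p e (comp m f μ ν) ρ =
      comp q g μ (fun i => comp (fun j => p (f ⟨i, j⟩)) (h i) (ν i) (fun j => ρ (f ⟨i, j⟩)))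

/-- Morphisms of `S`-modules. -/
structure SModule.Hom {k : Type u} [CommRing k] (V : SModule.{u, v} k) (W : SModule.{u, w} k) where
  app : ∀ n, V.obj n →ₗ[k] W.obj n
  map_act : ∀ n (σ : Equiv.Perm (Fin n)) (x : V.obj n), app n (V.act n σ x) = W.act n σ (app n x)

/-- Morphisms of operads. -/
@[ext]
structure SOperad.Hom {k : Type u} [CommRing k] (P : SOperad.{u, v} k) (Q : SOperad.{u, w} k) where
  app : ∀ n, P.obj n →ₗ[k] Q.obj n
  map_act : ∀ n (σ : Equiv.Perm (Fin n)) (x : P.obj n), app n (P.act n σ x) = Q.act n σ (app n x)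
  map_one : app 1 P.one = Q.one
  map_comp : ∀ {ℓ n : ℕ} (m : Fin ℓ → ℕ) (e : (Σ i, Fin (m i)) ≃ Fin n)
    (μ : P.obj ℓ) (ν : ∀ i, P.obj (m i)),
    app n (P.comp m e μ ν) = Q.comp m e (app ℓ μ) (fun i => app (m i) (ν i))

/-- Composition of operad morphisms (first `f`, then `g`). -/
def SOperad.Hom.trans {k : Type u} [CommRing k] {P : SOperad.{u, v} k} {Q : SOperad.{u, w} k}
    {R : SOperad.{u, x} k}
    (f : SOperad.Hom P Q) (g : SOperad.Hom Q R) : SOperad.Hom P R where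
  app n := (g.app n).comp (f.app n)
  map_act n σ x := by simp [f.map_act, g.map_act]
  map_one := by simp [f.map_one, g.map_one]
  map_comp m e μ ν := by simp [f.map_comp, g.map_comp]

section EndOperad

variable (k : Type u) [CommRing k] (A : Type w) [AddCommGroup A] [Module k A]

/-- The endomorphism operad of a `k`-module `A`: `End_A(n) = Hom(A^{⊗ n}, A)`. -/
def endOperad : SOperad.{u, w} k where
  obj n := MultilinearMap k (fun _ : Fin n => A) A
  act n :=
    { toFun := fun σ =>
        { toFun := fun f => f.domDomCongr σ
          map_add' := fun _ _ => rfl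
          map_smul' := fun _ _ => rfl }
      map_one' := rfl
      map_mul' := fun _ _ => rfl }
  one := MultilinearMap.ofSubsingleton k A A (0 : Fin 1) LinearMap.id
  comp {ℓ n} m e :=
    { toFun := fun μ =>
        { toFun := fun ν =>
            (μ.compMultilinearMap (N := fun i => fun _ : Fin (m i) => A) ν).domDomCongr e
          map_update_add' := fun {inst} ν i x y => by
            ext a
            have key : ∀ z, (fun j => (Function.update ν i z) j
                (fun b : Fin (m j) => a (e ⟨j, b⟩))) =
                Function.update (fun j => ν j (fun b : Fin (m j) => a (e ⟨j, b⟩))) i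
                  (z (fun b : Fin (m i) => a (e ⟨i, b⟩))) := by
              intro z
              funext j
              exact Function.apply_update
                (fun j (w : MultilinearMap k (fun _ : Fin (m j) => A) A) =>
                  w (fun b : Fin (m j) => a (e ⟨j, b⟩))) ν i z j
            simp only [MultilinearMap.domDomCongr_apply, MultilinearMap.compMultilinearMap_apply,
              _root_.add_apply]
            erw [key, key, key]
            exact μ.map_update_add _ _ _ _
          map_update_smul' := fun {inst} ν i c x => by
            ext a
            have key : ∀ z, (fun j => (Function.update ν i z) j
                (fun b : Fin (m j) => a (e ⟨j, b⟩))) =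
                Function.update (fun j => ν j (fun b : Fin (m j) => a (e ⟨j, b⟩))) i
                  (z (fun b : Fin (m i) => a (e ⟨i, b⟩))) := by
              intro z
              funext j
              exact Function.apply_update
                (fun j (w : MultilinearMap k (fun _ : Fin (m j) => A) A) =>
                  w (fun b : Fin (m j) => a (e ⟨j, b⟩))) ν i z j
            simp only [MultilinearMap.domDomCongr_apply, MultilinearMap.compMultilinearMap_apply,
              _root_.smul_apply]
            erw [key, key]
            exact μ.map_update_smul _ _ _ _ }
      map_add' := fun _ _ => rfl
      map_smul' := fun _ _ => rfl }
  act_comp _ _ _ _ _ := rfl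
  comp_act_left {ℓ n} m e σ e' μ ν he := by
    ext a
    exact congrArg μ (funext fun i => congrArg (ν (σ i)) (funext fun j =>
      congrArg a (he i j).symm))
  comp_act_right {ℓ n} m e e' s μ ν he := by
    ext a
    exact congrArg μ (funext fun i => congrArg (ν i) (funext fun j => congrArg a (he i j).symm))
  comp_one {n} e σ μ he := by
    ext a
    exact congrArg μ (funext fun i => congrArg a (he i))
  one_comp {n} e σ ν he := by
    ext a
    exact congrArg ν (funext fun j => congrArg a (he j))
  assoc {ℓ n N} m f p e q h g μ ν ρ H := by
    ext a
    exact congrArg μ (funext fun i => congrArg (ν i) (funext fun j =>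
      congrArg (ρ (f ⟨i, j⟩)) (funext fun l => congrArg a (H i j l))))

end EndOperad

/-! ### Operadic ideals and quotients -/

section Quotient

variable {k : Type u} [CommRing k] (Q : SOperad.{u, v} k)

/-- Membership in the operadic ideal `(R)` generated by a family `R` of sets of elements: the
smallest family of `k`-submodules that contains `R` and is closed under the symmetric group actions
and under composition in which at least one factor lies in the family. -/
inductive InIdeal (R : ∀ n, Set (Q.obj n)) : ∀ n, Q.obj n → Prop
  | of {n} {x : Q.obj n} : x ∈ R n → InIdeal R n x
  | zero {n} : InIdeal R n 0
  | add {n} {x y : Q.obj n} : InIdeal R n x → InIdeal R n y → InIdeal R n (x + y)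
  | smul {n} (c : k) {x : Q.obj n} : InIdeal R n x → InIdeal R n (c • x)
  | act {n} (σ : Equiv.Perm (Fin n)) {x : Q.obj n} : InIdeal R n x → InIdeal R n (Q.act n σ x)
  | comp_left {ℓ n} (m : Fin ℓ → ℕ) (e : (Σ i, Fin (m i)) ≃ Fin n) {μ : Q.obj ℓ}
      (ν : ∀ i, Q.obj (m i)) : InIdeal R ℓ μ → InIdeal R n (Q.comp m e μ ν)
  | comp_right {ℓ n} (m : Fin ℓ → ℕ) (e : (Σ i, Fin (m i)) ≃ Fin n) (μ : Q.obj ℓ)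
      (ν : ∀ i, Q.obj (m i)) (i : Fin ℓ) : InIdeal R (m i) (ν i) → InIdeal R n (Q.comp m e μ ν)

variable (R : ∀ n, Set (Q.obj n))

/-- The arity `n` part of the operadic ideal generated by `R`. -/
def ideal (n : ℕ) : Submodule k (Q.obj n) where
  carrier := {x | InIdeal Q R n x}
  zero_mem' := InIdeal.zero
  add_mem' := InIdeal.add
  smul_mem' c _ := InIdeal.smul c

theorem comp_sub_mem_ideal {ℓ n : ℕ} (m : Fin ℓ → ℕ) (e : (Σ i, Fin (m i)) ≃ Fin n)
    {μ μ' : Q.obj ℓ} {ν ν' : ∀ i, Q.obj (m i)} (hμ : μ - μ' ∈ ideal Q R ℓ)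
    (hν : ∀ i, ν i - ν' i ∈ ideal Q R (m i)) :
    Q.comp m e μ ν - Q.comp m e μ' ν' ∈ ideal Q R n := by
  classical
  have h1 : Q.comp m e μ ν - Q.comp m e μ' ν ∈ ideal Q R n := by
    have : Q.comp m e μ ν - Q.comp m e μ' ν = Q.comp m e (μ - μ') ν := by
      rw [map_sub]; rfl
    rw [this]
    exact InIdeal.comp_left m e ν hμ
  have h2 : ∀ s : Finset (Fin ℓ),
      Q.comp m e μ' (s.piecewise ν ν') - Q.comp m e μ' ν' ∈ ideal Q R n := by
    intro s
    induction s using Finset.induction_on with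
    | empty => simp
    | insert i s his ih =>
      have h3 : Q.comp m e μ' ((insert i s).piecewise ν ν') -
          Q.comp m e μ' (s.piecewise ν ν') ∈ ideal Q R n := by
        have hs : s.piecewise ν ν' = Function.update (s.piecewise ν ν') i (ν' i) := by
          rw [eq_comm, Function.update_eq_self_iff]
          simp [his]
        rw [Finset.piecewise_insert]
        nth_rewrite 2 [hs]
        rw [← MultilinearMap.map_update_sub]
        refine InIdeal.comp_right m e μ' _ i ?_
        rw [Function.update_self]
        exact hν i
      have := Submodule.add_mem _ h3 ih
      rwa [sub_add_sub_cancel] at this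
  have h4 := Submodule.add_mem _ h1 (by simpa using h2 Finset.univ)
  rwa [sub_add_sub_cancel] at h4

/-- Composition in the quotient operad, on representatives. -/
def quotComp {ℓ n : ℕ} (m : Fin ℓ → ℕ) (e : (Σ i, Fin (m i)) ≃ Fin n)
    (μ : Q.obj ℓ ⧸ ideal Q R ℓ) (ν : ∀ i, Q.obj (m i) ⧸ ideal Q R (m i)) :
    Q.obj n ⧸ ideal Q R n :=
  Submodule.Quotient.mk (Q.comp m e (Quotient.out μ) (fun i => Quotient.out (ν i)))

theorem quotComp_mk {ℓ n : ℕ} (m : Fin ℓ → ℕ) (e : (Σ i, Fin (m i)) ≃ Fin n)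
    (μ : Q.obj ℓ) (ν : ∀ i, Q.obj (m i)) :
    quotComp Q R m e (Submodule.Quotient.mk μ) (fun i => Submodule.Quotient.mk (ν i)) =
      Submodule.Quotient.mk (Q.comp m e μ ν) := by
  rw [quotComp, Submodule.Quotient.eq]
  refine comp_sub_mem_ideal Q R m e ?_ fun i => ?_
  · rw [← Submodule.Quotient.eq]
    exact Quotient.out_eq _
  · rw [← Submodule.Quotient.eq]
    exact Quotient.out_eq _

theorem exists_rep {ℓ : ℕ} (m : Fin ℓ → ℕ) (ν : ∀ i, Q.obj (m i) ⧸ ideal Q R (m i)) :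
    ∃ ν' : ∀ i, Q.obj (m i), ν = fun i => Submodule.Quotient.mk (ν' i) :=
  ⟨fun i => Quotient.out (ν i), funext fun _ => (Quotient.out_eq _).symm⟩

theorem mk_update {ℓ : ℕ} [DecidableEq (Fin ℓ)] (m : Fin ℓ → ℕ) (ν : ∀ i, Q.obj (m i))
    (i : Fin ℓ) (x : Q.obj (m i)) :
    Function.update (fun j => (Submodule.Quotient.mk (ν j) : Q.obj (m j) ⧸ ideal Q R (m j))) i
      (Submodule.Quotient.mk x) = fun j => Submodule.Quotient.mk (Function.update ν i x j) :=
  funext fun j => (Function.apply_update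
    (fun j (y : Q.obj (m j)) => (Submodule.Quotient.mk y : Q.obj (m j) ⧸ ideal Q R (m j)))
    ν i x j).symm

theorem quotComp_add {ℓ n : ℕ} (m : Fin ℓ → ℕ) (e : (Σ i, Fin (m i)) ≃ Fin n)
    (μ μ' : Q.obj ℓ ⧸ ideal Q R ℓ) (ν : ∀ i, Q.obj (m i) ⧸ ideal Q R (m i)) :
    quotComp Q R m e (μ + μ') ν = quotComp Q R m e μ ν + quotComp Q R m e μ' ν := by
  obtain ⟨μ, rfl⟩ := Submodule.Quotient.mk_surjective _ μ
  obtain ⟨μ', rfl⟩ := Submodule.Quotient.mk_surjective _ μ'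
  obtain ⟨ν, rfl⟩ := exists_rep Q R m ν
  rw [← Submodule.Quotient.mk_add, quotComp_mk, quotComp_mk, quotComp_mk, map_add]
  rfl

theorem quotComp_smul {ℓ n : ℕ} (m : Fin ℓ → ℕ) (e : (Σ i, Fin (m i)) ≃ Fin n)
    (c : k) (μ : Q.obj ℓ ⧸ ideal Q R ℓ) (ν : ∀ i, Q.obj (m i) ⧸ ideal Q R (m i)) :
    quotComp Q R m e (c • μ) ν = c • quotComp Q R m e μ ν := by
  obtain ⟨μ, rfl⟩ := Submodule.Quotient.mk_surjective _ μ
  obtain ⟨ν, rfl⟩ := exists_rep Q R m ν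
  rw [← Submodule.Quotient.mk_smul, quotComp_mk, quotComp_mk, map_smul]
  rfl

/-- The multilinear form of the composition in the quotient operad. -/
def quotCompHom {ℓ n : ℕ} (m : Fin ℓ → ℕ) (e : (Σ i, Fin (m i)) ≃ Fin n) :
    (Q.obj ℓ ⧸ ideal Q R ℓ) →ₗ[k]
      MultilinearMap k (fun i => Q.obj (m i) ⧸ ideal Q R (m i)) (Q.obj n ⧸ ideal Q R n) where
  toFun μ :=
    { toFun := fun ν => quotComp Q R m e μ ν
      map_update_add' := fun ν i x y => by
        obtain ⟨μ, rfl⟩ := Submodule.Quotient.mk_surjective _ μ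
        obtain ⟨ν, rfl⟩ := exists_rep Q R m ν
        obtain ⟨x, rfl⟩ := Submodule.Quotient.mk_surjective _ x
        obtain ⟨y, rfl⟩ := Submodule.Quotient.mk_surjective _ y
        rw [← Submodule.Quotient.mk_add, mk_update, mk_update, mk_update, quotComp_mk,
          quotComp_mk, quotComp_mk, MultilinearMap.map_update_add, Submodule.Quotient.mk_add]
      map_update_smul' := fun ν i c x => by
        obtain ⟨μ, rfl⟩ := Submodule.Quotient.mk_surjective _ μ
        obtain ⟨ν, rfl⟩ := exists_rep Q R m ν
        obtain ⟨x, rfl⟩ := Submodule.Quotient.mk_surjective _ x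
        rw [← Submodule.Quotient.mk_smul, mk_update, mk_update, quotComp_mk,
          quotComp_mk, MultilinearMap.map_update_smul, Submodule.Quotient.mk_smul] }
  map_add' μ μ' := by
    ext ν
    exact quotComp_add Q R m e μ μ' ν
  map_smul' c μ := by
    ext ν
    exact quotComp_smul Q R m e c μ ν

theorem quotCompHom_mk {ℓ n : ℕ} (m : Fin ℓ → ℕ) (e : (Σ i, Fin (m i)) ≃ Fin n)
    (μ : Q.obj ℓ) (ν : ∀ i, Q.obj (m i)) :
    quotCompHom Q R m e (Submodule.Quotient.mk μ) (fun i => Submodule.Quotient.mk (ν i)) =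
      Submodule.Quotient.mk (Q.comp m e μ ν) :=
  quotComp_mk Q R m e μ ν

/-- The symmetric group action on the quotient operad. -/
def quotAct (n : ℕ) : Representation k (Equiv.Perm (Fin n)) (Q.obj n ⧸ ideal Q R n) where
  toFun σ := (ideal Q R n).mapQ (ideal Q R n) (Q.act n σ) fun _ hx => InIdeal.act σ hx
  map_one' := by
    ext x
    simp
  map_mul' σ τ := by
    refine LinearMap.ext fun x => ?_
    obtain ⟨x, rfl⟩ := Submodule.Quotient.mk_surjective _ x
    simp only [Submodule.mapQ_apply, Module.End.mul_apply, map_mul]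
    rfl

theorem quotAct_mk {n : ℕ} (σ : Equiv.Perm (Fin n)) (x : Q.obj n) :
    quotAct Q R n σ (Submodule.Quotient.mk x) = Submodule.Quotient.mk (Q.act n σ x) :=
  rfl

/-- The quotient operad `Q / (R)`. -/
def SOperad.quotient : SOperad.{u, v} k where
  obj n := Q.obj n ⧸ ideal Q R n
  act := quotAct Q R
  one := Submodule.Quotient.mk Q.one
  comp m e := quotCompHom Q R m e
  act_comp m e σ μ ν := by
    obtain ⟨μ, rfl⟩ := Submodule.Quotient.mk_surjective _ μ
    obtain ⟨ν, rfl⟩ := exists_rep Q R m ν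
    rw [quotCompHom_mk, quotCompHom_mk, quotAct_mk, Q.act_comp]
  comp_act_left m e σ e' μ ν he := by
    obtain ⟨μ, rfl⟩ := Submodule.Quotient.mk_surjective _ μ
    obtain ⟨ν, rfl⟩ := exists_rep Q R m ν
    rw [quotAct_mk, quotCompHom_mk, Q.comp_act_left m e σ e' μ ν he, ← quotCompHom_mk]
  comp_act_right m e e' s μ ν he := by
    obtain ⟨μ, rfl⟩ := Submodule.Quotient.mk_surjective _ μ
    obtain ⟨ν, rfl⟩ := exists_rep Q R m ν
    simp only [quotAct_mk]
    rw [quotCompHom_mk, quotCompHom_mk, Q.comp_act_right m e e' s μ ν he]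
  comp_one e σ μ he := by
    obtain ⟨μ, rfl⟩ := Submodule.Quotient.mk_surjective _ μ
    rw [quotAct_mk, ← Q.comp_one e σ μ he, ← quotCompHom_mk]
  one_comp e σ ν he := by
    obtain ⟨ν, rfl⟩ := Submodule.Quotient.mk_surjective _ ν
    rw [quotAct_mk, ← Q.one_comp e σ ν he, ← quotCompHom_mk]
  assoc m f p e q h g μ ν ρ H := by
    obtain ⟨μ, rfl⟩ := Submodule.Quotient.mk_surjective _ μ
    obtain ⟨ν, rfl⟩ := exists_rep Q R m ν
    obtain ⟨ρ, rfl⟩ := exists_rep Q R p ρ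
    rw [quotCompHom_mk, quotCompHom_mk, Q.assoc m f p e q h g μ ν ρ H, ← quotCompHom_mk]
    simp only [← quotCompHom_mk]

/-- The projection `Q → Q / (R)`. -/
def SOperad.proj : SOperad.Hom Q (Q.quotient R) where
  app n := (ideal Q R n).mkQ
  map_act _ _ _ := rfl
  map_one := rfl
  map_comp m e μ ν := (quotComp_mk Q R m e μ ν).symm

end Quotient

/-! ### The free operad on an `S`-module -/

section Free

variable {k : Type u} [CommRing k] (V : SModule.{u, v} k)

/-- Formal operadic expressions in the elements of an `S`-module `V`. -/
inductive FreeTerm : ℕ → Type (max u v)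
  | gen {n : ℕ} : V.obj n → FreeTerm n
  | one : FreeTerm 1
  | act {n : ℕ} : Equiv.Perm (Fin n) → FreeTerm n → FreeTerm n
  | comp {ℓ n : ℕ} (m : Fin ℓ → ℕ) : ((Σ i, Fin (m i)) ≃ Fin n) → FreeTerm ℓ →
      (∀ i, FreeTerm (m i)) → FreeTerm n
  | zero {n : ℕ} : FreeTerm n
  | add {n : ℕ} : FreeTerm n → FreeTerm n → FreeTerm n
  | smul {n : ℕ} : k → FreeTerm n → FreeTerm n

open FreeTerm in
/-- The congruence on formal operadic expressions generated by the axioms of `k`-modules, of linear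
symmetric group actions and of operads, and by the condition that `V → T(V)` is a morphism of
`S`-modules. -/
inductive FreeRel : ∀ {n : ℕ}, FreeTerm V n → FreeTerm V n → Prop
  | refl {n} (a : FreeTerm V n) : FreeRel a a
  | symm {n} {a b : FreeTerm V n} : FreeRel a b → FreeRel b a
  | trans {n} {a b c : FreeTerm V n} : FreeRel a b → FreeRel b c → FreeRel a c
  | act_congr {n} (σ : Equiv.Perm (Fin n)) {a b : FreeTerm V n} :
      FreeRel a b → FreeRel (act σ a) (act σ b)
  | comp_congr {ℓ n} (m : Fin ℓ → ℕ) (e : (Σ i, Fin (m i)) ≃ Fin n) {a b : FreeTerm V ℓ}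
      {c d : ∀ i, FreeTerm V (m i)} :
      FreeRel a b → (∀ i, FreeRel (c i) (d i)) → FreeRel (comp m e a c) (comp m e b d)
  | add_congr {n} {a b c d : FreeTerm V n} :
      FreeRel a b → FreeRel c d → FreeRel (add a c) (add b d)
  | smul_congr {n} (r : k) {a b : FreeTerm V n} : FreeRel a b → FreeRel (smul r a) (smul r b)
  -- module axioms
  | add_assoc {n} (a b c : FreeTerm V n) : FreeRel (add (add a b) c) (add a (add b c))
  | add_comm {n} (a b : FreeTerm V n) : FreeRel (add a b) (add b a)
  | zero_add {n} (a : FreeTerm V n) : FreeRel (add zero a) a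
  | one_smul {n} (a : FreeTerm V n) : FreeRel (smul 1 a) a
  | mul_smul {n} (r s : k) (a : FreeTerm V n) : FreeRel (smul (r * s) a) (smul r (smul s a))
  | smul_add {n} (r : k) (a b : FreeTerm V n) :
      FreeRel (smul r (add a b)) (add (smul r a) (smul r b))
  | add_smul {n} (r s : k) (a : FreeTerm V n) :
      FreeRel (smul (r + s) a) (add (smul r a) (smul s a))
  | zero_smul {n} (a : FreeTerm V n) : FreeRel (smul 0 a) zero
  -- generators
  | gen_add {n} (x y : V.obj n) : FreeRel (gen (x + y)) (add (gen x) (gen y))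
  | gen_smul {n} (r : k) (x : V.obj n) : FreeRel (gen (r • x)) (smul r (gen x))
  | gen_act {n} (σ : Equiv.Perm (Fin n)) (x : V.obj n) :
      FreeRel (gen (V.act n σ x)) (act σ (gen x))
  -- linear action of the symmetric groups
  | act_add {n} (σ : Equiv.Perm (Fin n)) (a b : FreeTerm V n) :
      FreeRel (act σ (add a b)) (add (act σ a) (act σ b))
  | act_smul {n} (σ : Equiv.Perm (Fin n)) (r : k) (a : FreeTerm V n) :
      FreeRel (act σ (smul r a)) (smul r (act σ a))
  | act_one {n} (a : FreeTerm V n) : FreeRel (act 1 a) a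
  | act_mul {n} (σ τ : Equiv.Perm (Fin n)) (a : FreeTerm V n) :
      FreeRel (act (σ * τ) a) (act σ (act τ a))
  -- multilinearity of the composition
  | comp_add_left {ℓ n} (m : Fin ℓ → ℕ) (e : (Σ i, Fin (m i)) ≃ Fin n) (a b : FreeTerm V ℓ)
      (c : ∀ i, FreeTerm V (m i)) :
      FreeRel (comp m e (add a b) c) (add (comp m e a c) (comp m e b c))
  | comp_smul_left {ℓ n} (m : Fin ℓ → ℕ) (e : (Σ i, Fin (m i)) ≃ Fin n) (r : k) (a : FreeTerm V ℓ)
      (c : ∀ i, FreeTerm V (m i)) :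
      FreeRel (comp m e (smul r a) c) (smul r (comp m e a c))
  | comp_add_right {ℓ n} (m : Fin ℓ → ℕ) (e : (Σ i, Fin (m i)) ≃ Fin n) (a : FreeTerm V ℓ)
      (c : ∀ i, FreeTerm V (m i)) (i : Fin ℓ) (x y : FreeTerm V (m i)) :
      FreeRel (comp m e a (Function.update c i (add x y)))
        (add (comp m e a (Function.update c i x)) (comp m e a (Function.update c i y)))
  | comp_smul_right {ℓ n} (m : Fin ℓ → ℕ) (e : (Σ i, Fin (m i)) ≃ Fin n) (a : FreeTerm V ℓ)
      (c : ∀ i, FreeTerm V (m i)) (i : Fin ℓ) (r : k) (x : FreeTerm V (m i)) :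
      FreeRel (comp m e a (Function.update c i (smul r x)))
        (smul r (comp m e a (Function.update c i x)))
  -- operad axioms
  | act_comp {ℓ n} (m : Fin ℓ → ℕ) (e : (Σ i, Fin (m i)) ≃ Fin n)
      (σ : Equiv.Perm (Fin n)) (a : FreeTerm V ℓ) (c : ∀ i, FreeTerm V (m i)) :
      FreeRel (act σ (comp m e a c)) (comp m (e.trans σ) a c)
  | comp_act_left {ℓ n} (m : Fin ℓ → ℕ) (e : (Σ i, Fin (m i)) ≃ Fin n)
      (σ : Equiv.Perm (Fin ℓ)) (e' : (Σ i, Fin (m (σ i))) ≃ Fin n)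
      (a : FreeTerm V ℓ) (c : ∀ i, FreeTerm V (m i)) (h : ∀ i j, e' ⟨i, j⟩ = e ⟨σ i, j⟩) :
      FreeRel (comp m e (act σ a) c) (comp (fun i => m (σ i)) e' a (fun i => c (σ i)))
  | comp_act_right {ℓ n} (m : Fin ℓ → ℕ) (e e' : (Σ i, Fin (m i)) ≃ Fin n)
      (s : ∀ i, Equiv.Perm (Fin (m i))) (a : FreeTerm V ℓ) (c : ∀ i, FreeTerm V (m i))
      (h : ∀ i j, e' ⟨i, j⟩ = e ⟨i, s i j⟩) :
      FreeRel (comp m e a (fun i => act (s i) (c i))) (comp m e' a c)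
  | comp_one {n} (e : (Σ _ : Fin n, Fin 1) ≃ Fin n) (σ : Equiv.Perm (Fin n)) (a : FreeTerm V n)
      (h : ∀ i, e ⟨i, 0⟩ = σ i) : FreeRel (comp (fun _ => 1) e a (fun _ => one)) (act σ a)
  | one_comp {n} (e : (Σ _ : Fin 1, Fin n) ≃ Fin n) (σ : Equiv.Perm (Fin n)) (a : FreeTerm V n)
      (h : ∀ j, e ⟨0, j⟩ = σ j) : FreeRel (comp (fun _ => n) e one (fun _ => a)) (act σ a)
  | assoc {ℓ n N} (m : Fin ℓ → ℕ) (f : (Σ i, Fin (m i)) ≃ Fin n)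
      (p : Fin n → ℕ) (e : (Σ x, Fin (p x)) ≃ Fin N)
      (q : Fin ℓ → ℕ) (h : ∀ i, (Σ j, Fin (p (f ⟨i, j⟩))) ≃ Fin (q i))
      (g : (Σ i, Fin (q i)) ≃ Fin N)
      (a : FreeTerm V ℓ) (c : ∀ i, FreeTerm V (m i)) (d : ∀ x, FreeTerm V (p x))
      (H : ∀ i j l, e ⟨f ⟨i, j⟩, l⟩ = g ⟨i, h i ⟨j, l⟩⟩) :
      FreeRel (comp p e (comp m f a c) d)
        (comp q g a
          (fun i => comp (fun j => p (f ⟨i, j⟩)) (h i) (c i) (fun j => d (f ⟨i, j⟩))))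

instance freeSetoid (n : ℕ) : Setoid (FreeTerm V n) :=
  ⟨FreeRel V, FreeRel.refl, FreeRel.symm, FreeRel.trans⟩

/-- The arity `n` part of the free operad. -/
def FreeObj (n : ℕ) : Type (max u v) := Quotient (freeSetoid V n)

variable {V} in
/-- The class of a formal expression. -/
def FreeTerm.cls {n : ℕ} (a : FreeTerm V n) : FreeObj V n := Quotient.mk (freeSetoid V n) a

variable {V} in
theorem FreeRel.cls_eq {n : ℕ} {a b : FreeTerm V n} (h : FreeRel V a b) : a.cls = b.cls :=
  Quotient.sound h

variable {V} in
theorem FreeObj.exists_rep {n : ℕ} (x : FreeObj V n) : ∃ a : FreeTerm V n, a.cls = x :=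
  Quotient.exists_rep x

variable {V} in
theorem FreeObj.exists_reps {ℓ : ℕ} {m : Fin ℓ → ℕ} (x : ∀ i, FreeObj V (m i)) :
    ∃ a : ∀ i, FreeTerm V (m i), (fun i => (a i).cls) = x :=
  ⟨fun i => Quotient.out (x i), funext fun i => Quotient.out_eq (x i)⟩

instance (n : ℕ) : Zero (FreeObj V n) := ⟨FreeTerm.zero.cls⟩

instance (n : ℕ) : Add (FreeObj V n) :=
  ⟨Quotient.map₂ FreeTerm.add fun _ _ h _ _ h' => FreeRel.add_congr h h'⟩

instance (n : ℕ) : SMul k (FreeObj V n) :=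
  ⟨fun r => Quotient.map (FreeTerm.smul r) fun _ _ h => FreeRel.smul_congr r h⟩

instance (n : ℕ) : Neg (FreeObj V n) := ⟨fun x => (-1 : k) • x⟩

variable {V} in
theorem FreeObj.add_cls {n : ℕ} (a b : FreeTerm V n) : a.cls + b.cls = (a.add b).cls := rfl

variable {V} in
theorem FreeObj.smul_cls {n : ℕ} (r : k) (a : FreeTerm V n) : r • a.cls = (a.smul r).cls := rfl

instance (n : ℕ) : AddCommGroup (FreeObj V n) where
  add_assoc x y z := by
    obtain ⟨a, rfl⟩ := x.exists_rep
    obtain ⟨b, rfl⟩ := y.exists_rep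
    obtain ⟨c, rfl⟩ := z.exists_rep
    exact (FreeRel.add_assoc a b c).cls_eq
  zero_add x := by
    obtain ⟨a, rfl⟩ := x.exists_rep
    exact (FreeRel.zero_add a).cls_eq
  add_zero x := by
    obtain ⟨a, rfl⟩ := x.exists_rep
    exact ((FreeRel.add_comm a _).trans (FreeRel.zero_add a)).cls_eq
  add_comm x y := by
    obtain ⟨a, rfl⟩ := x.exists_rep
    obtain ⟨b, rfl⟩ := y.exists_rep
    exact (FreeRel.add_comm a b).cls_eq
  neg_add_cancel x := by
    obtain ⟨a, rfl⟩ := x.exists_rep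
    refine FreeRel.cls_eq (a := .add (.smul (-1) a) a) (b := .zero) ?_
    have h := (FreeRel.add_smul (-1 : k) 1 a).symm
    rw [neg_add_cancel] at h
    exact ((FreeRel.add_congr (FreeRel.refl _) (FreeRel.one_smul a).symm).trans h).trans
      (FreeRel.zero_smul a)
  nsmul := nsmulRec
  zsmul := zsmulRec

instance (n : ℕ) : Module k (FreeObj V n) where
  one_smul x := by
    obtain ⟨a, rfl⟩ := x.exists_rep
    exact (FreeRel.one_smul a).cls_eq
  mul_smul r s x := by
    obtain ⟨a, rfl⟩ := x.exists_rep
    exact (FreeRel.mul_smul r s a).cls_eq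
  smul_add r x y := by
    obtain ⟨a, rfl⟩ := x.exists_rep
    obtain ⟨b, rfl⟩ := y.exists_rep
    exact (FreeRel.smul_add r a b).cls_eq
  add_smul r s x := by
    obtain ⟨a, rfl⟩ := x.exists_rep
    exact (FreeRel.add_smul r s a).cls_eq
  zero_smul x := by
    obtain ⟨a, rfl⟩ := x.exists_rep
    exact (FreeRel.zero_smul a).cls_eq
  smul_zero r := by
    have h : FreeRel V (n := n) (.smul r .zero) .zero :=
      ((FreeRel.smul_congr r (FreeRel.zero_smul FreeTerm.zero).symm).trans
        (FreeRel.mul_smul r 0 FreeTerm.zero).symm).trans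
        (by rw [mul_zero]; exact FreeRel.zero_smul _)
    exact h.cls_eq

/-- The symmetric group action on the free operad. -/
def freeAct (n : ℕ) : Representation k (Equiv.Perm (Fin n)) (FreeObj V n) where
  toFun σ :=
    { toFun := Quotient.map (FreeTerm.act σ) fun _ _ h => FreeRel.act_congr σ h
      map_add' := fun x y => by
        obtain ⟨a, rfl⟩ := x.exists_rep
        obtain ⟨b, rfl⟩ := y.exists_rep
        exact (FreeRel.act_add σ a b).cls_eq
      map_smul' := fun r x => by
        obtain ⟨a, rfl⟩ := x.exists_rep
        exact (FreeRel.act_smul σ r a).cls_eq }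
  map_one' := by
    refine LinearMap.ext fun x => ?_
    obtain ⟨a, rfl⟩ := x.exists_rep
    exact (FreeRel.act_one a).cls_eq
  map_mul' σ τ := by
    refine LinearMap.ext fun x => ?_
    obtain ⟨a, rfl⟩ := x.exists_rep
    exact (FreeRel.act_mul σ τ a).cls_eq

theorem freeAct_cls {n : ℕ} (σ : Equiv.Perm (Fin n)) (a : FreeTerm V n) :
    freeAct V n σ a.cls = (a.act σ).cls := rfl

/-- Composition in the free operad, on representatives. -/
def freeComp {ℓ n : ℕ} (m : Fin ℓ → ℕ) (e : (Σ i, Fin (m i)) ≃ Fin n)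
    (x : FreeObj V ℓ) (y : ∀ i, FreeObj V (m i)) : FreeObj V n :=
  (FreeTerm.comp m e (Quotient.out x) (fun i => Quotient.out (y i))).cls

theorem freeComp_cls {ℓ n : ℕ} (m : Fin ℓ → ℕ) (e : (Σ i, Fin (m i)) ≃ Fin n)
    (a : FreeTerm V ℓ) (c : ∀ i, FreeTerm V (m i)) :
    freeComp V m e a.cls (fun i => (c i).cls) = (FreeTerm.comp m e a c).cls :=
  (FreeRel.comp_congr m e (Quotient.mk_out (s := freeSetoid V ℓ) a)
    fun i => Quotient.mk_out (s := freeSetoid V (m i)) (c i)).cls_eq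

theorem update_cls {ℓ : ℕ} [DecidableEq (Fin ℓ)] (m : Fin ℓ → ℕ) (c : ∀ i, FreeTerm V (m i))
    (i : Fin ℓ) (x : FreeTerm V (m i)) :
    Function.update (fun j => (c j).cls) i x.cls = fun j => (Function.update c i x j).cls :=
  funext fun j => (Function.apply_update (fun _ y => FreeTerm.cls y) c i x j).symm

/-- The multilinear form of the composition in the free operad. -/
def freeCompHom {ℓ n : ℕ} (m : Fin ℓ → ℕ) (e : (Σ i, Fin (m i)) ≃ Fin n) :
    FreeObj V ℓ →ₗ[k] MultilinearMap k (fun i => FreeObj V (m i)) (FreeObj V n) where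
  toFun x :=
    { toFun := fun y => freeComp V m e x y
      map_update_add' := fun {inst} y i z w => by
        obtain rfl := Subsingleton.elim inst (instDecidableEqFin ℓ)
        obtain ⟨a, rfl⟩ := x.exists_rep
        obtain ⟨c, rfl⟩ := FreeObj.exists_reps y
        obtain ⟨z, rfl⟩ := z.exists_rep
        obtain ⟨w, rfl⟩ := w.exists_rep
        rw [FreeObj.add_cls, update_cls, update_cls, update_cls, freeComp_cls, freeComp_cls,
          freeComp_cls, FreeObj.add_cls]
        exact (FreeRel.comp_add_right m e a c i z w).cls_eq
      map_update_smul' := fun {inst} y i r z => by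
        obtain rfl := Subsingleton.elim inst (instDecidableEqFin ℓ)
        obtain ⟨a, rfl⟩ := x.exists_rep
        obtain ⟨c, rfl⟩ := FreeObj.exists_reps y
        obtain ⟨z, rfl⟩ := z.exists_rep
        rw [FreeObj.smul_cls, update_cls, update_cls, freeComp_cls, freeComp_cls,
          FreeObj.smul_cls]
        exact (FreeRel.comp_smul_right m e a c i r z).cls_eq }
  map_add' x x' := by
    ext y
    obtain ⟨a, rfl⟩ := x.exists_rep
    obtain ⟨b, rfl⟩ := x'.exists_rep
    obtain ⟨c, rfl⟩ := FreeObj.exists_reps y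
    change freeComp V m e (a.add b).cls _ = freeComp V m e _ _ + freeComp V m e _ _
    rw [freeComp_cls, freeComp_cls, freeComp_cls, FreeObj.add_cls]
    exact (FreeRel.comp_add_left m e a b c).cls_eq
  map_smul' r x := by
    ext y
    obtain ⟨a, rfl⟩ := x.exists_rep
    obtain ⟨c, rfl⟩ := FreeObj.exists_reps y
    change freeComp V m e (a.smul r).cls _ = r • freeComp V m e _ _
    rw [freeComp_cls, freeComp_cls, FreeObj.smul_cls]
    exact (FreeRel.comp_smul_left m e r a c).cls_eq

theorem freeCompHom_cls {ℓ n : ℕ} (m : Fin ℓ → ℕ) (e : (Σ i, Fin (m i)) ≃ Fin n)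
    (a : FreeTerm V ℓ) (c : ∀ i, FreeTerm V (m i)) :
    freeCompHom V m e a.cls (fun i => (c i).cls) = (FreeTerm.comp m e a c).cls :=
  freeComp_cls V m e a c

/-- The free operad `T(V)` on an `S`-module `V`. -/
def freeOperad : SOperad.{u, max u v} k where
  obj := FreeObj V
  act := freeAct V
  one := FreeTerm.one.cls
  comp m e := freeCompHom V m e
  act_comp m e σ μ ν := by
    obtain ⟨a, rfl⟩ := μ.exists_rep
    obtain ⟨c, rfl⟩ := FreeObj.exists_reps ν
    rw [freeCompHom_cls, freeCompHom_cls, freeAct_cls]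
    exact (FreeRel.act_comp m e σ a c).cls_eq
  comp_act_left m e σ e' μ ν h := by
    obtain ⟨a, rfl⟩ := μ.exists_rep
    obtain ⟨c, rfl⟩ := FreeObj.exists_reps ν
    rw [freeAct_cls, freeCompHom_cls, (FreeRel.comp_act_left m e σ e' a c h).cls_eq,
      ← freeCompHom_cls]
  comp_act_right m e e' s μ ν h := by
    obtain ⟨a, rfl⟩ := μ.exists_rep
    obtain ⟨c, rfl⟩ := FreeObj.exists_reps ν
    simp only [freeAct_cls]
    rw [freeCompHom_cls, freeCompHom_cls, (FreeRel.comp_act_right m e e' s a c h).cls_eq]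
  comp_one e σ μ h := by
    obtain ⟨a, rfl⟩ := μ.exists_rep
    rw [freeAct_cls, ← (FreeRel.comp_one e σ a h).cls_eq, ← freeCompHom_cls]
  one_comp e σ ν h := by
    obtain ⟨a, rfl⟩ := ν.exists_rep
    rw [freeAct_cls, ← (FreeRel.one_comp e σ a h).cls_eq, ← freeCompHom_cls]
  assoc m f p e q h g μ ν ρ H := by
    obtain ⟨a, rfl⟩ := μ.exists_rep
    obtain ⟨c, rfl⟩ := FreeObj.exists_reps ν
    obtain ⟨d, rfl⟩ := FreeObj.exists_reps ρ
    rw [freeCompHom_cls, freeCompHom_cls, (FreeRel.assoc m f p e q h g a c d H).cls_eq,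
      ← freeCompHom_cls]
    simp only [← freeCompHom_cls]

/-- The inclusion of generators `V → T(V)`. -/
def freeGen (n : ℕ) : V.obj n →ₗ[k] (freeOperad V).obj n where
  toFun x := (FreeTerm.gen x).cls
  map_add' x y := (FreeRel.gen_add x y).cls_eq
  map_smul' r x := (FreeRel.gen_smul r x).cls_eq

theorem freeGen_act (n : ℕ) (σ : Equiv.Perm (Fin n)) (x : V.obj n) :
    freeGen V n (V.act n σ x) = (freeOperad V).act n σ (freeGen V n x) :=
  (FreeRel.gen_act σ x).cls_eq

variable {V} {Q : SOperad.{u, w} k} (φ : SModule.Hom V Q.toSModule)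

/-- The value in an operad `Q` of a formal expression, given the values of the generators. -/
def FreeTerm.eval : ∀ {n : ℕ}, FreeTerm V n → Q.obj n
  | n, .gen x => φ.app n x
  | _, .one => Q.one
  | n, .act σ a => Q.act n σ a.eval
  | _, .comp m e a c => Q.comp m e a.eval (fun i => (c i).eval)
  | _, .zero => 0
  | _, .add a b => a.eval + b.eval
  | _, .smul r a => r • a.eval

theorem FreeRel.eval_eq {n : ℕ} {a b : FreeTerm V n} (h : FreeRel V a b) :
    a.eval φ = b.eval φ := by
  induction h with
  | refl a => rfl
  | symm _ ih => exact ih.symm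
  | trans _ _ ih ih' => exact ih.trans ih'
  | act_congr σ _ ih => simp only [FreeTerm.eval, ih]
  | comp_congr m e _ _ ih ih' => simp only [FreeTerm.eval, ih, ih']
  | add_congr _ _ ih ih' => simp only [FreeTerm.eval, ih, ih']
  | smul_congr r _ ih => simp only [FreeTerm.eval, ih]
  | add_assoc a b c => exact _root_.add_assoc _ _ _
  | add_comm a b => exact _root_.add_comm _ _
  | zero_add a => exact _root_.zero_add _
  | one_smul a => exact _root_.one_smul _ _
  | mul_smul r s a => exact SemigroupAction.mul_smul _ _ _
  | smul_add r a b => exact _root_.smul_add _ _ _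
  | add_smul r s a => exact _root_.add_smul _ _ _
  | zero_smul a => exact _root_.zero_smul _ _
  | gen_add x y => exact map_add _ _ _
  | gen_smul r x => exact map_smul _ _ _
  | gen_act σ x => exact φ.map_act _ _ _
  | act_add σ a b => exact map_add _ _ _
  | act_smul σ r a => exact map_smul _ _ _
  | act_one a => simp [FreeTerm.eval]
  | act_mul σ τ a => simp [FreeTerm.eval]
  | comp_add_left m e a b c => simp [FreeTerm.eval]
  | comp_smul_left m e r a c => simp [FreeTerm.eval]
  | comp_add_right m e a c i x y =>
    have key : ∀ z, (fun j => (Function.update c i z j).eval φ) =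
        Function.update (fun j => (c j).eval φ) i (z.eval φ) := fun z =>
      funext fun j => Function.apply_update (fun _ y => FreeTerm.eval φ y) c i z j
    simp only [FreeTerm.eval, key, MultilinearMap.map_update_add]
  | comp_smul_right m e a c i r x =>
    have key : ∀ z, (fun j => (Function.update c i z j).eval φ) =
        Function.update (fun j => (c j).eval φ) i (z.eval φ) := fun z =>
      funext fun j => Function.apply_update (fun _ y => FreeTerm.eval φ y) c i z j
    simp only [FreeTerm.eval, key, MultilinearMap.map_update_smul]
  | act_comp m e σ a c => exact Q.act_comp _ _ _ _ _
  | comp_act_left m e σ e' a c h => exact Q.comp_act_left m e σ e' _ (fun i => (c i).eval φ) h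
  | comp_act_right m e e' s a c h => exact Q.comp_act_right m e e' s _ (fun i => (c i).eval φ) h
  | comp_one e σ a h => exact Q.comp_one e σ _ h
  | one_comp e σ a h => exact Q.one_comp e σ _ h
  | assoc m f p e q h g a c d H =>
    exact Q.assoc m f p e q h g _ (fun i => (c i).eval φ) (fun x => (d x).eval φ) H

/-- The morphism `T(V) → Q` induced by a morphism of `S`-modules `V → Q`. -/
def freeLift : SOperad.Hom (freeOperad V) Q where
  app n :=
    { toFun := Quotient.lift (FreeTerm.eval φ) fun _ _ h => FreeRel.eval_eq φ h
      map_add' := fun x y => by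
        obtain ⟨a, rfl⟩ := FreeObj.exists_rep x
        obtain ⟨b, rfl⟩ := FreeObj.exists_rep y
        rfl
      map_smul' := fun r x => by
        obtain ⟨a, rfl⟩ := FreeObj.exists_rep x
        rfl }
  map_act n σ x := by
    obtain ⟨a, rfl⟩ := FreeObj.exists_rep x
    rfl
  map_one := rfl
  map_comp m e μ ν := by
    obtain ⟨a, rfl⟩ := FreeObj.exists_rep μ
    obtain ⟨c, rfl⟩ := FreeObj.exists_reps ν
    exact congrArg (Quotient.lift (FreeTerm.eval φ) fun _ _ h => FreeRel.eval_eq φ h)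
      (freeCompHom_cls V m e a c)

@[simp]
theorem freeLift_gen (n : ℕ) (x : V.obj n) : (freeLift φ).app n (freeGen V n x) = φ.app n x := rfl

/-- A morphism out of the free operad is determined by its values on the generators. -/
theorem freeLift_unique (f : SOperad.Hom (freeOperad V) Q)
    (hf : ∀ n x, f.app n (freeGen V n x) = φ.app n x) : f = freeLift φ := by
  have key : ∀ {n} (a : FreeTerm V n), f.app n a.cls = a.eval φ := by
    intro n a
    induction a with
    | gen x => exact hf _ x
    | one => exact f.map_one
    | act σ a ih => exact (f.map_act _ σ a.cls).trans (congrArg _ ih)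
    | comp m e a c ih ih' =>
      rw [← freeCompHom_cls]
      refine (f.map_comp m e a.cls (fun i => (c i).cls)).trans ?_
      simp only [ih, ih']
      rfl
    | zero => exact map_zero (f.app _)
    | add a b ih ih' => exact (map_add (f.app _) a.cls b.cls).trans (congrArg₂ (· + ·) ih ih')
    | smul r a ih => exact (map_smul (f.app _) r a.cls).trans (congrArg (r • ·) ih)
  refine SOperad.Hom.ext (funext fun n => LinearMap.ext fun x => ?_)
  obtain ⟨a, rfl⟩ := FreeObj.exists_rep x
  exact key a

end Free

/-! ### Labelled trees and configurations -/

/-- Labelled `n`-trees: reduced planar rooted trees (every vertex has at least two inputs) with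
`n` leaves, whose vertices with `ℓ` inputs are decorated by elements of `D ℓ` and whose leaves are
labelled by the elements of `Fin n`, each used once. `leaf` is the trivial tree, and
`graft _ m e ω τ` is the grafting `ω(τ₁ ∨ ⋯ ∨ τ_ℓ)`, where the leaf of the `i`-th branch that is
labelled `j` in `τ i` gets the label `e ⟨i, j⟩`. -/
inductive LTree (D : ℕ → Type v) : ℕ → Type v
  | leaf : LTree D 1
  | graft {ℓ n : ℕ} (hℓ : 2 ≤ ℓ) (m : Fin ℓ → ℕ) (e : (Σ i, Fin (m i)) ≃ Fin n) (ω : D ℓ)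
      (τ : ∀ i, LTree D (m i)) : LTree D n

/-- `J ∩ Lin(τ_i)`, for a grafting whose leaves are labelled through `e`, as a set of leaf labels
of the tree `τ_i`. -/
def branchSet {ℓ n : ℕ} {m : Fin ℓ → ℕ} (e : (Σ i, Fin (m i)) ≃ Fin n) (J : Finset (Fin n))
    (i : Fin ℓ) : Finset (Fin (m i)) :=
  Finset.univ.filter fun j => e ⟨i, j⟩ ∈ J

/-- `J ⊓ ω` for the root vertex `ω` of a grafting whose leaves are labelled through `e`: the set of
inputs `i` of `ω` with `J ∩ Lin(τ_i) ≠ ∅`. -/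
def meet {ℓ n : ℕ} {m : Fin ℓ → ℕ} (e : (Σ i, Fin (m i)) ≃ Fin n) (J : Finset (Fin n)) :
    Finset (Fin ℓ) :=
  Finset.univ.filter fun i => (branchSet e J i).Nonempty

/-- The leaf labels increase from left to right. -/
def LTree.IsPlanar {D : ℕ → Type v} : ∀ {n : ℕ}, LTree D n → Prop
  | _, .leaf => True
  | _, .graft _ _ e _ τ =>
    (∀ i i' j j', i < i' → e ⟨i, j⟩ < e ⟨i', j'⟩) ∧ (∀ i j j', j < j' → e ⟨i, j⟩ < e ⟨i, j'⟩) ∧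
      ∀ i, (τ i).IsPlanar

/-- `J ⊓ ω ∈ S_{|In(ω)|}` for every vertex `ω` of the tree with `J ⊓ ω ≠ ∅`. -/
def LTree.MeetsIn {D : ℕ → Type v} (S : ∀ n, Finset (Finset (Fin n))) :
    ∀ {n : ℕ}, LTree D n → Finset (Fin n) → Prop
  | _, .leaf, _ => True
  | _, .graft (ℓ := ℓ) _ _ e _ τ, J =>
    ((meet e J).Nonempty → meet e J ∈ S ℓ) ∧ ∀ i, (τ i).MeetsIn S (branchSet e J i)

/-- A configuration: a sequence of sets `C_n` of nonempty subsets of `[n]` such that, for `J ∈ C_n`,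
every `n`-tree (with leaves numbered from left to right) and every vertex `ω` of it,
`J ⊓ ω ∈ C_{|In(ω)|}` whenever `J ⊓ ω ≠ ∅`. -/
structure Configuration where
  sets : ∀ n, Finset (Finset (Fin n))
  nonempty_of_mem : ∀ {n : ℕ} {I : Finset (Fin n)}, I ∈ sets n → I.Nonempty
  meetsIn_of_mem : ∀ {n : ℕ} {J : Finset (Fin n)}, J ∈ sets n →
    ∀ τ : LTree (fun _ => Unit) n, τ.IsPlanar → τ.MeetsIn sets J

/-- `S`-invariance of a configuration. -/
def Configuration.SInvariant (C : Configuration) : Prop :=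
  ∀ (n : ℕ) (σ : Equiv.Perm (Fin n)) (I : Finset (Fin n)),
    I ∈ C.sets n → I.map σ.toEmbedding ∈ C.sets n

/-! ### Operads presented by generators and relations -/

section Presented

variable {k : Type u} [CommRing k]

/-- The value of a labelled tree in an operad, given the values of its decorations. -/
def LTree.val {D : ℕ → Type v} {Q : SOperad.{u, w} k} (φ : ∀ n, D n → Q.obj n) :
    ∀ {n : ℕ}, LTree D n → Q.obj n
  | _, .leaf => Q.one
  | _, .graft (ℓ := ℓ) _ m e ω τ => Q.comp m e (φ ℓ ω) (fun i => (τ i).val φ)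

/-- The value of a linear combination of labelled `n`-trees. -/
def relVal {D : ℕ → Type v} {Q : SOperad.{u, w} k} (φ : ∀ n, D n → Q.obj n) (n : ℕ) :
    (LTree D n →₀ k) →ₗ[k] Q.obj n :=
  Finsupp.linearCombination k (LTree.val φ)

variable (V : SModule.{u, v} k) (R : ∀ n, Set (LTree V.obj n →₀ k))

/-- The relations `r = ∑ cᵢ τᵢ` of `R` as elements of the free operad `T(V)`. -/
def relations (n : ℕ) : Set ((freeOperad V).obj n) :=
  relVal (fun m x => freeGen V m x) n '' R n

/-- The operad `T(V)/(R)`, for a set `R` of linear combinations of labelled trees, each of which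
is homogeneous (its trees have the same leaf labels `[n]`). -/
def presOperad : SOperad.{u, max u v} k := (freeOperad V).quotient (relations V R)

/-- The projection `T(V) → T(V)/(R)`. -/
def presProj : SOperad.Hom (freeOperad V) (presOperad V R) := (freeOperad V).proj (relations V R)

variable {A : Type w} [AddCommGroup A] [Module k A]

/-- The `n`-ary operation on a `T(V)/(R)`-algebra `A` (given by a morphism `α` to the endomorphism
operad of `A`) that a generator `ω ∈ V(n)` defines. -/
def operation {V : SModule.{u, v} k} {R : ∀ n, Set (LTree V.obj n →₀ k)}
    (α : SOperad.Hom (presOperad V R) (endOperad k A)) {n : ℕ} (ω : V.obj n) :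
    MultilinearMap k (fun _ : Fin n => A) A :=
  α.app n ((presProj V R).app n (freeGen V n ω))

end Presented

/-! ### Splittings -/

section Splitting

variable {k : Type u} [CommRing k] (C : Configuration) (hC : C.SInvariant) (V : SModule.{u, v} k)
  (R : ∀ n, Set (LTree V.obj n →₀ k))

/-- The permutation `I ↦ σ(I)` of `C_n`. -/
def permSet (n : ℕ) (σ : Equiv.Perm (Fin n)) (I : {I // I ∈ C.sets n}) : {I // I ∈ C.sets n} :=
  ⟨I.1.map σ.toEmbedding, hC n σ I.1 I.2⟩

/-- The action `e_I ↦ e_{σ(I)}` on `⨁_{I ∈ C_n} k e_I`. -/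
def setRep (k : Type u) [CommRing k] (n : ℕ) :
    Representation k (Equiv.Perm (Fin n)) ({I // I ∈ C.sets n} →₀ k) where
  toFun σ := Finsupp.lmapDomain k k (permSet C hC n σ)
  map_one' := by
    ext I : 2
    have : permSet C hC n 1 I = I := Subtype.ext (Finset.map_refl (s := I.1))
    simp [this]
  map_mul' σ τ := by
    ext I : 2
    have : permSet C hC n (σ * τ) I = permSet C hC n σ (permSet C hC n τ I) :=
      Subtype.ext (by simp [permSet, Finset.map_map]; rfl)
    simp [this]

open scoped TensorProduct in
/-- The `S`-module `CSp(V)`, with `CSp(V)(n) = V(n) ⊗ (⨁_{I ∈ C_n} k e_I)` and the action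
`(ω ⊗ e_I)^σ = ω^σ ⊗ e_{σ(I)}`. -/
def splitModule : SModule.{u, max u v} k where
  obj n := V.obj n ⊗[k] ({I // I ∈ C.sets n} →₀ k)
  act n := (V.act n).tprod (setRep C hC k n)

/-- The generator `(ω, e_I) = ω ⊗ e_I` of `CSp(V)`. -/
def splitGen {n : ℕ} (ω : V.obj n) (I : {I // I ∈ C.sets n}) : (splitModule C hC V).obj n :=
  TensorProduct.tmul k ω (Finsupp.single I 1)

/-- The decoration that replaces a decoration `ω ∈ V(ℓ)` in the splitting: `(ω, e_I)` if
`I = J ⊓ ω` is not empty, and `(ω, *) = ∑_{I ∈ C_ℓ} (ω, e_I)` if it is empty. (The value `0` for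
nonempty `I ∉ C_ℓ` is never used when `J ∈ C_n`.) -/
def splitVertex {ℓ : ℕ} (ω : V.obj ℓ) (I : Finset (Fin ℓ)) : (splitModule C hC V).obj ℓ :=
  if I = ∅ then ∑ I' : {I // I ∈ C.sets ℓ}, splitGen C hC V ω I'
  else if h : I ∈ C.sets ℓ then splitGen C hC V ω ⟨I, h⟩
  else 0

/-- The splitting `CSp_J(τ)` of a labelled tree `τ`, for a set `J` of leaf labels, where
`CSp_∅(τ) = CSp(τ)` has every decoration `ω` replaced by `(ω, *)`. -/
def splitTree : ∀ {n : ℕ}, Finset (Fin n) → LTree V.obj n → LTree (splitModule C hC V).obj n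
  | _, _, .leaf => .leaf
  | _, J, .graft hℓ m e ω τ =>
    .graft hℓ m e (splitVertex C hC V ω (meet e J)) fun i => splitTree (branchSet e J i) (τ i)

/-- The relations `CSp_J(r) = ∑ cᵢ CSp_J(τᵢ)` for `r = ∑ cᵢ τᵢ ∈ R` and `J ∈ C_n`. -/
def splitRel (n : ℕ) : Set (LTree (splitModule C hC V).obj n →₀ k) :=
  {s | ∃ r ∈ R n, ∃ J ∈ C.sets n, s = Finsupp.mapDomain (splitTree C hC V J) r}

/-- The `C`-splitting `CSp(P) = T(CSp(V))/(CSp(R))` of the operad `P = T(V)/(R)`. -/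
def splitOperad : SOperad.{u, max u v} k := presOperad (splitModule C hC V) (splitRel C hC V R)

end Splitting

/-! ### Rota-Baxter operators -/

section RotaBaxter

variable {k : Type u} [CommRing k]

/-- The numbering of the inputs of `μ ∘ (ν₁ ⊗ ⋯ ⊗ ν_n)` for unary `ν_i`. -/
def unaryEquiv (n : ℕ) : (Σ _ : Fin n, Fin 1) ≃ Fin n where
  toFun x := x.1
  invFun i := ⟨i, 0⟩
  left_inv _ := Sigma.ext rfl (heq_of_eq (Subsingleton.elim _ _))
  right_inv _ := rfl

/-- The numbering of the inputs of `P ∘ μ` for a unary `P`. -/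
def postEquiv (n : ℕ) : (Σ _ : Fin 1, Fin n) ≃ Fin n where
  toFun x := x.2
  invFun j := ⟨0, j⟩
  left_inv _ := Sigma.ext (Subsingleton.elim _ _) HEq.rfl
  right_inv _ := rfl

/-- `μ ∘ P^{⊗ n, I}`: the composite of `μ` with the identity at the inputs in `I` and with the unary
operation `P` at the other inputs. -/
def insertAway {Q : SOperad.{u, w} k} (P : Q.obj 1) {n : ℕ} (μ : Q.obj n) (I : Finset (Fin n)) :
    Q.obj n :=
  Q.comp (fun _ => 1) (unaryEquiv n) μ (fun i => if i ∈ I then Q.one else P)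

/-- `P ∘ μ` for a unary operation `P`. -/
def postComp {Q : SOperad.{u, w} k} (P : Q.obj 1) {n : ℕ} (μ : Q.obj n) : Q.obj n :=
  Q.comp (fun _ => n) (postEquiv n) P (fun _ => μ)

variable (C : Configuration) (hC : C.SInvariant) (V : SModule.{u, v} k)
  (R : ∀ n, Set (LTree V.obj n →₀ k))

/-- The `S`-module `V_P = V ⊕ k P`, with the new generator `P` in arity `1`. -/
def withP : SModule.{u, max u v} k where
  obj n := V.obj n × (if n = 1 then (⊤ : Submodule k k) else ⊥ : Submodule k k)
  act n :=
    { toFun := fun σ => (V.act n σ).prodMap LinearMap.id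
      map_one' := by
        ext <;> simp
      map_mul' := fun σ τ => by
        ext <;> simp }

/-- The element of `T(V_P)` given by `ω ∈ V(n)`. -/
def genV (n : ℕ) : V.obj n →ₗ[k] (freeOperad (withP V)).obj n :=
  (freeGen (withP V) n).comp (LinearMap.inl k _ _)

/-- The element `P` of `T(V_P)`. -/
def genP : (freeOperad (withP V)).obj 1 :=
  freeGen (withP V) 1 (0, ⟨1, by simp⟩)

/-- `ω ↦ ω ∘ P^{⊗ n, I}`. -/
def insertMap (n : ℕ) (I : Finset (Fin n)) : V.obj n →ₗ[k] (freeOperad (withP V)).obj n where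
  toFun ω := insertAway (genP V) (genV V n ω) I
  map_add' ω ω' := by
    simp only [insertAway, map_add]
    rfl
  map_smul' r ω := by
    simp only [insertAway, map_smul]
    rfl

theorem genV_act {n : ℕ} (σ : Equiv.Perm (Fin n)) (ω : V.obj n) :
    genV V n (V.act n σ ω) = (freeOperad (withP V)).act n σ (genV V n ω) := by
  exact freeGen_act (withP V) n σ (ω, 0)

theorem insertMap_act {n : ℕ} (σ : Equiv.Perm (Fin n)) (ω : V.obj n) (I : Finset (Fin n)) :
    insertMap V n (I.map σ.toEmbedding) (V.act n σ ω) =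
      (freeOperad (withP V)).act n σ (insertMap V n I ω) := by
  change insertAway _ (genV V n _) _ = SModule.act _ n σ (insertAway _ _ _)
  rw [genV_act, insertAway, insertAway, SOperad.act_comp,
    SOperad.comp_act_left _ (fun _ => 1) (unaryEquiv n) σ ((unaryEquiv n).trans σ) _ _
      (fun _ _ => rfl)]
  congr 1
  funext i
  simp

open scoped TensorProduct in
/-- The linear map `V(n) ⊗ (⨁_{I ∈ C_n} k e_I) → T(V_P)(n)`, `ω ⊗ e_I ↦ ω ∘ P^{⊗ n, I}`. -/
def xiMap (n : ℕ) :
    V.obj n ⊗[k] ({I // I ∈ C.sets n} →₀ k) →ₗ[k] (freeOperad (withP V)).obj n :=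
  TensorProduct.lift
    (Finsupp.linearCombination k fun I : {I // I ∈ C.sets n} => insertMap V n I.1).flip

theorem xiMap_tmul_single {n : ℕ} (ω : V.obj n) (I : {I // I ∈ C.sets n}) (c : k) :
    xiMap C V n (TensorProduct.tmul k ω (Finsupp.single I c)) = c • insertMap V n I.1 ω := by
  simp [xiMap]

theorem xiMap_act (n : ℕ) (σ : Equiv.Perm (Fin n)) :
    (xiMap C V n).comp ((V.act n).tprod (setRep C hC k n) σ) =
      ((freeOperad (withP V)).act n σ).comp (xiMap C V n) := by
  refine TensorProduct.ext' fun ω f => ?_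
  induction f using Finsupp.induction_linear with
  | zero => simp
  | add f g hf hg => simp only [TensorProduct.tmul_add, map_add, hf, hg]
  | single I c =>
    rw [LinearMap.comp_apply, LinearMap.comp_apply, Representation.tprod_apply,
      TensorProduct.map_tmul, xiMap_tmul_single, map_smul, ← insertMap_act]
    have : setRep C hC k n σ (Finsupp.single I c) = Finsupp.single (permSet C hC n σ I) c := by
      simp [setRep]
    rw [this, xiMap_tmul_single]
    rfl

/-- The morphism of `S`-modules `ξ : CSp(V) → T(V_P)`, `(ω, e_I) ↦ ω ∘ P^{⊗ n, I}`. -/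
def xi : SModule.Hom (splitModule C hC V) (freeOperad (withP V)).toSModule where
  app n := xiMap C V n
  map_act n σ x := LinearMap.congr_fun (xiMap_act C hC V n σ) x

@[simp]
theorem xi_splitGen {n : ℕ} (ω : V.obj n) (I : {I // I ∈ C.sets n}) :
    (xi C hC V).app n (splitGen C hC V ω I) = insertAway (genP V) (genV V n ω) I.1 := by
  exact (xiMap_tmul_single C V ω I 1).trans (one_smul k _)

/-- The relations of the operad of `C`-Rota-Baxter `P`-algebras: the relations `R` of `P`, and
`ω ∘ P^{⊗ n} - ∑_{I ∈ C_n} P ∘ ω ∘ P^{⊗ n, I}` for `ω ∈ V(n)`. -/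
def rbRelations (n : ℕ) : Set ((freeOperad (withP V)).obj n) :=
  relVal (fun m x => genV V m x) n '' R n ∪
    Set.range fun ω : V.obj n => insertAway (genP V) (genV V n ω) ∅ -
      ∑ I ∈ C.sets n, postComp (genP V) (insertAway (genP V) (genV V n ω) I)

/-- The operad `CRB(P) = T(V_P)/(R, CRB)` of `C`-Rota-Baxter `P`-algebras, for `P = T(V)/(R)`. -/
def rbOperad : SOperad.{u, max u v} k := (freeOperad (withP V)).quotient (rbRelations C V R)

/-- The projection `T(V_P) → CRB(P)`. -/
def rbProj : SOperad.Hom (freeOperad (withP V)) (rbOperad C V R) :=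
  (freeOperad (withP V)).proj (rbRelations C V R)

variable {V R} {A : Type w} [AddCommGroup A] [Module k A]

/-- The tuple `P^{⊗, I} x`: `x i` for `i ∈ I` and `P (x i)` for `i ∉ I`. -/
def applyAway (P : A →ₗ[k] A) {n : ℕ} (I : Finset (Fin n)) (x : Fin n → A) : Fin n → A :=
  fun i => if i ∈ I then x i else P (x i)

/-- A `C`-Rota-Baxter operator (of weight one) on a `T(V)/(R)`-algebra `A`: a linear map `P` with
`ω(P x₁, …, P x_n) = P (∑_{I ∈ C_n} ω(P^{⊗, I} x))` for every generating operation `ω`. -/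
def IsRotaBaxter (α : SOperad.Hom (presOperad V R) (endOperad k A)) (P : A →ₗ[k] A) : Prop :=
  ∀ (n : ℕ) (ω : V.obj n) (x : Fin n → A),
    operation α ω (fun i => P (x i)) = P (∑ I ∈ C.sets n, operation α ω (applyAway P I x))

end RotaBaxter

end OperadSplitting

end

open OperadSplitting

/-! The proof is a computation with a single tree, carried out in any operad `Q` that has a unary
element `p` and images of the generators satisfying the Rota–Baxter relations, with each `(ω, e_I)`
interpreted as `ω ∘ P^{⊗ℓ,I}`.

Two statements are proved by induction on a decorated tree `τ`. With no distinguished leaf, `P ∘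
CSp_∅(τ) = τ ∘ P^{⊗n}` (`postComp_splitTree_empty`): a `P` above the root vertex `(ω, *)` is traded
by the Rota–Baxter relation for a `P` at every input of `ω`, and each of these is pushed through its
branch by induction. With `J` nonempty, `CSp_J(τ) = τ ∘ P^{⊗n,J}` (`splitTree_val`): the root
becomes `ω ∘ P^{⊗ℓ,J⊓ω}`, so a branch that meets `J` is handled by induction, while a branch
disjoint from `J` appears as `P ∘ CSp_∅` of that branch, which is the first statement. By linearity
a split relation `CSp_J(r)` takes the value `r ∘ P^{⊗n,J}`, which is `0` as soon as `r` is
(`relVal_splitRel`).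

The second statement requires `J ⊓ ω ∈ C_ℓ` at every vertex that `J` meets. A configuration promises
this only for trees numbered from left to right. An arbitrarily labelled tree is renumbered by a
permutation `σ` (`LTree.exists_planar`), and `S`-invariance places `σ(J)` in `C_n`.

The first part of the theorem takes `Q = CRB(P)`. For the second, a Rota–Baxter operator on `A`
extends the algebra structure to a morphism `CRB(P) → End_A` (`rbAlgebra`), and precomposing it with
the morphism of the first part gives the `CSp(P)`-algebra. Uniqueness holds because a morphism out
of a presented operad is determined by its values on generators. -/

noncomputable section

namespace OperadSplitting

/-! ### Unary operations inserted at the inputs and the output of a composite -/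

section Calculus

variable {k : Type u} [CommRing k] {Q : SOperad.{u, w} k} (p : Q.obj 1)

theorem postComp_one_left {n : ℕ} (ν : Q.obj n) :
    Q.comp (fun _ => n) (postEquiv n) Q.one (fun _ => ν) = ν := by
  rw [Q.one_comp (postEquiv n) 1 ν (fun _ => rfl), map_one]
  rfl

theorem postComp_one : postComp p Q.one = p := by
  refine (Q.comp_one (postEquiv 1) 1 p fun i => Subsingleton.elim _ _).trans ?_
  rw [map_one]
  rfl

theorem insertAway_one (J : Finset (Fin 1)) :
    insertAway p Q.one J = if 0 ∈ J then Q.one else p := by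
  have h : (fun i => if i ∈ J then Q.one else p : Fin 1 → Q.obj 1) =
      fun _ => if 0 ∈ J then Q.one else p := by
    funext i
    rw [Subsingleton.elim i 0]
  rw [insertAway, h]
  refine (Q.one_comp (unaryEquiv 1) 1 _ fun i => Subsingleton.elim _ _).trans ?_
  rw [map_one]
  rfl

/-- Associativity lets a `P` sitting at an input of `μ` be read as sitting on the output of the
branch grafted there, while the identities at the inputs in `I` disappear. This step turns a
decoration `e_I` into statements about branches. -/
theorem comp_insertAway {ℓ n : ℕ} (m : Fin ℓ → ℕ) (e : (Σ i, Fin (m i)) ≃ Fin n)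
    (μ : Q.obj ℓ) (I : Finset (Fin ℓ)) (ν : ∀ i, Q.obj (m i)) :
    Q.comp m e (insertAway p μ I) ν =
      Q.comp m e μ (fun i => if i ∈ I then ν i else postComp p (ν i)) := by
  refine (Q.assoc (fun _ => 1) (unaryEquiv ℓ) m e m (fun i => postEquiv (m i)) e μ
    (fun i => if i ∈ I then Q.one else p) ν fun _ _ _ => rfl).trans ?_
  congr 1
  funext i
  split_ifs
  · exact postComp_one_left (ν i)
  · rfl

/-- An instance of associativity: the unary operations at the leaves are sorted by branch, and the
set of exempt leaves is cut down accordingly. It supplies the other side of both tree inductions. -/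
theorem insertAway_comp {ℓ n : ℕ} (m : Fin ℓ → ℕ) (e : (Σ i, Fin (m i)) ≃ Fin n)
    (μ : Q.obj ℓ) (ν : ∀ i, Q.obj (m i)) (J : Finset (Fin n)) :
    insertAway p (Q.comp m e μ ν) J =
      Q.comp m e μ (fun i => insertAway p (ν i) (branchSet e J i)) := by
  refine (Q.assoc m e (fun _ => 1) (unaryEquiv n) m (fun i => unaryEquiv (m i)) e μ ν
    (fun i => if i ∈ J then Q.one else p) fun _ _ _ => rfl).trans ?_
  simp [insertAway, branchSet]

theorem postComp_comp {ℓ n : ℕ} (m : Fin ℓ → ℕ) (e : (Σ i, Fin (m i)) ≃ Fin n)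
    (μ : Q.obj ℓ) (ν : ∀ i, Q.obj (m i)) :
    postComp p (Q.comp m e μ ν) = Q.comp m e (postComp p μ) ν :=
  (Q.assoc (fun _ => ℓ) (postEquiv ℓ) m e (fun _ => n) (fun _ => e) (postEquiv n) p
    (fun _ => μ) ν fun _ _ _ => rfl).symm

/-- `μ ↦ μ ∘ P^{⊗ n, I}` as a linear map. -/
def insertAwayHom (n : ℕ) (I : Finset (Fin n)) : Q.obj n →ₗ[k] Q.obj n where
  toFun μ := insertAway p μ I
  map_add' μ μ' := by
    simp only [insertAway, map_add]
    rfl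
  map_smul' c μ := by
    simp only [insertAway, map_smul]
    rfl

/-- `μ ↦ P ∘ μ` as a linear map. -/
def postCompHom (n : ℕ) : Q.obj n →ₗ[k] Q.obj n where
  toFun μ := postComp p μ
  map_add' μ μ' := by
    -- `P` has a single input, so a constant family is an update at that input, and multilinearity
    -- in one slot becomes plain linearity.
    have key : ∀ z : Q.obj n, (fun _ : Fin 1 => z) =
        Function.update (fun _ : Fin 1 => (0 : Q.obj n)) 0 z := fun z => by
      funext i
      rw [Subsingleton.elim i 0, Function.update_self]
    simp only [postComp]
    rw [key (μ + μ'), key μ, key μ']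
    exact MultilinearMap.map_update_add (Q.comp (fun _ => n) (postEquiv n) p) _ _ _ _
  map_smul' c μ := by
    have key : ∀ z : Q.obj n, (fun _ : Fin 1 => z) =
        Function.update (fun _ : Fin 1 => (0 : Q.obj n)) 0 z := fun z => by
      funext i
      rw [Subsingleton.elim i 0, Function.update_self]
    simp only [postComp]
    rw [key (c • μ), key μ]
    exact MultilinearMap.map_update_smul (Q.comp (fun _ => n) (postEquiv n) p) _ _ _ _

theorem SOperad.Hom.map_insertAway {Q' : SOperad.{u, x} k} (f : SOperad.Hom Q Q') {n : ℕ}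
    (μ : Q.obj n) (I : Finset (Fin n)) :
    f.app n (insertAway p μ I) = insertAway (f.app 1 p) (f.app n μ) I := by
  rw [insertAway, f.map_comp, insertAway]
  congr 1
  funext i
  split_ifs
  · exact f.map_one
  · rfl

theorem SOperad.Hom.map_postComp {Q' : SOperad.{u, x} k} (f : SOperad.Hom Q Q') {n : ℕ}
    (μ : Q.obj n) : f.app n (postComp p μ) = postComp (f.app 1 p) (f.app n μ) :=
  f.map_comp _ _ _ _

theorem SOperad.Hom.map_val {Q' : SOperad.{u, x} k} (f : SOperad.Hom Q Q') {D : ℕ → Type v}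
    (φ : ∀ n, D n → Q.obj n) {n : ℕ} (τ : LTree D n) :
    f.app n (τ.val φ) = τ.val fun m y => f.app m (φ m y) := by
  induction τ with
  | leaf => exact f.map_one
  | graft hℓ m e ω τ ih =>
    simp only [LTree.val, f.map_comp, ih]

theorem SOperad.Hom.map_relVal {Q' : SOperad.{u, x} k} (f : SOperad.Hom Q Q') {D : ℕ → Type v}
    (φ : ∀ n, D n → Q.obj n) {n : ℕ} (r : LTree D n →₀ k) :
    f.app n (relVal φ n r) = relVal (fun m y => f.app m (φ m y)) n r := by
  simp only [relVal, Finsupp.linearCombination_apply, Finsupp.sum, map_sum, map_smul, f.map_val]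

end Calculus

/-! ### Morphisms out of a quotient operad -/

section Descent

variable {k : Type u} [CommRing k] {Q : SOperad.{u, v} k} {Q' : SOperad.{u, w} k}
  {R : ∀ n, Set (Q.obj n)}

/-- The kernel of a morphism is itself an operadic ideal, so it contains the one generated by `R`.
-/
theorem SOperad.Hom.eq_zero_of_mem_ideal (f : SOperad.Hom Q Q')
    (hf : ∀ n, ∀ x ∈ R n, f.app n x = 0) {n : ℕ} {x : Q.obj n} (hx : x ∈ ideal Q R n) :
    f.app n x = 0 := by
  change InIdeal Q R n x at hx
  induction hx with
  | of h => exact hf _ _ h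
  | zero => exact map_zero _
  | add _ _ h h' => rw [map_add, h, h', add_zero]
  | smul c _ h => rw [map_smul, h, smul_zero]
  | act σ _ h => rw [f.map_act, h, map_zero]
  | comp_left m e ν _ h => rw [f.map_comp, h, map_zero]; rfl
  | comp_right m e μ ν i _ h =>
    rw [f.map_comp]
    exact MultilinearMap.map_coord_zero _ i h

/-- The morphism `Q / (R) → Q'` induced by a morphism `Q → Q'` that vanishes on `R`. -/
def SOperad.Hom.descend (f : SOperad.Hom Q Q') (hf : ∀ n, ∀ x ∈ R n, f.app n x = 0) :
    SOperad.Hom (Q.quotient R) Q' where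
  app n := (ideal Q R n).liftQ (f.app n) fun _ hx => f.eq_zero_of_mem_ideal hf hx
  map_act n σ y := by
    obtain ⟨y, rfl⟩ := Submodule.Quotient.mk_surjective _ y
    exact f.map_act n σ y
  map_one := f.map_one
  map_comp m e μ ν := by
    obtain ⟨μ, rfl⟩ := Submodule.Quotient.mk_surjective _ μ
    obtain ⟨ν, rfl⟩ := exists_rep Q R m ν
    exact (congrArg _ (quotComp_mk Q R m e μ ν)).trans (f.map_comp m e μ ν)

theorem SOperad.Hom.ext_of_proj {f g : SOperad.Hom (Q.quotient R) Q'}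
    (h : (Q.proj R).trans f = (Q.proj R).trans g) : f = g := by
  refine SOperad.Hom.ext (funext fun n => LinearMap.ext fun y => ?_)
  obtain ⟨y, rfl⟩ := Submodule.Quotient.mk_surjective _ y
  exact LinearMap.congr_fun (congrFun (congrArg SOperad.Hom.app h) n) y

end Descent

theorem SOperad.proj_eq_zero {k : Type u} [CommRing k] {Q : SOperad.{u, v} k}
    {R : ∀ n, Set (Q.obj n)} {n : ℕ} {x : Q.obj n} (hx : x ∈ R n) : (Q.proj R).app n x = 0 :=
  (Submodule.Quotient.mk_eq_zero _).2 (InIdeal.of hx)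

/-! ### Configurations and trees with arbitrary leaf labels -/

section Planar

/-- Renumbering the leaves of a tree from left to right. -/
theorem LTree.exists_planar {D : ℕ → Type v} {n : ℕ} (τ : LTree D n) :
    ∃ (σ : Equiv.Perm (Fin n)) (τ' : LTree (fun _ => Unit) n), τ'.IsPlanar ∧
      ∀ (S : ∀ n, Finset (Finset (Fin n))) (J : Finset (Fin n)),
        τ'.MeetsIn S (J.map σ.toEmbedding) → τ.MeetsIn S J := by
  induction τ with
  | leaf => exact ⟨1, .leaf, trivial, fun _ _ _ => trivial⟩
  | @graft ℓ n hℓ m e ω τ ih =>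
    choose s τ' hτ' hS using ih
    -- Left-to-right order on the leaves is lexicographic: first the branch, then the position
    -- within the branch once that branch has been renumbered by induction.
    let o : Fin n ≃o Σₗ i, Fin (m i) := Fintype.orderIsoFinOfCardEq _
      ((Fintype.card_congr (ofLex.trans e)).trans (Fintype.card_fin n))
    let e' : (Σ i, Fin (m i)) ≃ Fin n := toLex.trans o.symm.toEquiv
    have he' : ∀ y z, toLex y < toLex z → e' y < e' z := fun y z h => o.symm.lt_iff_lt.2 h
    -- Find the branch and label of a leaf, apply that branch's own renumbering `s i`, and number
    -- the result lexicographically.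
    let σ : Equiv.Perm (Fin n) := (e.symm.trans (Equiv.sigmaCongrRight s)).trans e'
    -- The renumbering never moves a leaf to another branch. It therefore acts on each branch set by
    -- `s i`, and leaves the meet at the root unchanged.
    have hb : ∀ (J : Finset (Fin n)) i,
        branchSet e' (J.map σ.toEmbedding) i = (branchSet e J i).map (s i).toEmbedding := by
      intro J i
      ext j
      obtain ⟨j, rfl⟩ := (s i).surjective j
      have : e' ⟨i, s i j⟩ = σ (e ⟨i, j⟩) := by simp [σ]
      simp [branchSet, this]
    have hm : ∀ J : Finset (Fin n), meet e' (J.map σ.toEmbedding) = meet e J := by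
      intro J
      ext i
      simp [meet, hb]
    refine ⟨σ, .graft hℓ m e' () τ', ⟨?_, ?_, hτ'⟩, fun S J h => ⟨?_, fun i => ?_⟩⟩
    · intro i i' j j' h
      exact he' _ _ (Sigma.Lex.left _ _ h)
    · intro i j j' h
      exact he' _ _ (Sigma.Lex.right _ _ h)
    · have := h.1
      rwa [hm] at this
    · have := h.2 i
      rw [hb] at this
      exact hS i S _ this

/-- `S`-invariance is what lets the configuration axiom, given for left-to-right numberings, be
applied to the renumbered tree and the moved set `σ(J)`. -/
theorem Configuration.SInvariant.meetsIn {C : Configuration} (hC : C.SInvariant)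
    {D : ℕ → Type v} {n : ℕ} (τ : LTree D n) {J : Finset (Fin n)} (hJ : J ∈ C.sets n) :
    τ.MeetsIn C.sets J := by
  obtain ⟨σ, τ', hτ', h⟩ := τ.exists_planar
  exact h _ _ (C.meetsIn_of_mem (hC n σ J hJ) τ' hτ')

end Planar

/-! ### Values of split trees under the Rota–Baxter relations -/

section Main

variable {k : Type u} [CommRing k] {C : Configuration} {hC : C.SInvariant} {V : SModule.{u, v} k}
  {Q : SOperad.{u, w} k} {p : Q.obj 1} {g : ∀ n, V.obj n →ₗ[k] Q.obj n}
  {h : ∀ n, (splitModule C hC V).obj n →ₗ[k] Q.obj n}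

theorem meet_empty {ℓ n : ℕ} {m : Fin ℓ → ℕ} (e : (Σ i, Fin (m i)) ≃ Fin n) :
    meet e ∅ = ∅ := by
  simp [meet, branchSet]

theorem branchSet_empty {ℓ n : ℕ} {m : Fin ℓ → ℕ} (e : (Σ i, Fin (m i)) ≃ Fin n) (i : Fin ℓ) :
    branchSet e ∅ i = ∅ := by
  simp [branchSet]

/-- Every leaf lies in some branch, so a vertex reached with a nonempty `J` is never decorated by
the sum `(ω, *)`. -/
theorem meet_nonempty {ℓ n : ℕ} {m : Fin ℓ → ℕ} (e : (Σ i, Fin (m i)) ≃ Fin n)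
    {J : Finset (Fin n)} (hJ : J.Nonempty) : (meet e J).Nonempty := by
  obtain ⟨y, hy⟩ := hJ
  obtain ⟨⟨i, j⟩, rfl⟩ := e.surjective y
  exact ⟨i, by simpa [meet] using ⟨j, by simpa [branchSet] using hy⟩⟩

/-- `P ∘ CSp_∅(τ) = τ ∘ P^{⊗ n}` under the Rota-Baxter relations. -/
theorem postComp_splitTree_empty
    (hg : ∀ n (ω : V.obj n) (I : {I // I ∈ C.sets n}),
      h n (splitGen C hC V ω I) = insertAway p (g n ω) I.1)
    (hp : ∀ n (ω : V.obj n), insertAway p (g n ω) ∅ =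
      ∑ I ∈ C.sets n, postComp p (insertAway p (g n ω) I))
    {n : ℕ} (τ : LTree V.obj n) :
    postComp p ((splitTree C hC V ∅ τ).val fun m => h m) =
      insertAway p (τ.val fun m => g m) ∅ := by
  induction τ with
  | leaf => simp [splitTree, LTree.val, postComp_one, insertAway_one]
  | @graft ℓ n hℓ m e ω τ ih =>
    -- This is the Rota–Baxter relation read from right to left: `P` applied to `(ω, *)` is exactly
    -- its sum over `C_ℓ`.
    have hω : postComp p (h ℓ (splitVertex C hC V ω ∅)) = insertAway p (g ℓ ω) ∅ := by
      rw [hp, splitVertex, if_pos rfl, map_sum]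
      simp only [hg]
      refine (map_sum (postCompHom p ℓ) _ _).trans ?_
      exact Finset.sum_coe_sort (C.sets ℓ) fun I => postComp p (insertAway p (g ℓ ω) I)
    simp only [splitTree, LTree.val, meet_empty, branchSet_empty]
    rw [postComp_comp, hω, comp_insertAway, insertAway_comp]
    simp [ih, branchSet_empty]

/-- `CSp_J(τ) = τ ∘ P^{⊗ n, J}` under the Rota-Baxter relations. -/
theorem splitTree_val
    (hg : ∀ n (ω : V.obj n) (I : {I // I ∈ C.sets n}),
      h n (splitGen C hC V ω I) = insertAway p (g n ω) I.1)
    (hp : ∀ n (ω : V.obj n), insertAway p (g n ω) ∅ =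
      ∑ I ∈ C.sets n, postComp p (insertAway p (g n ω) I))
    {n : ℕ} (τ : LTree V.obj n) {J : Finset (Fin n)} (hJ : J.Nonempty)
    (hτ : τ.MeetsIn C.sets J) :
    (splitTree C hC V J τ).val (fun m => h m) = insertAway p (τ.val fun m => g m) J := by
  induction τ with
  | leaf =>
    obtain ⟨i, hi⟩ := hJ
    rw [Subsingleton.elim i 0] at hi
    simp [splitTree, LTree.val, insertAway_one, hi]
  | @graft ℓ n hℓ m e ω τ ih =>
    have hm := meet_nonempty e hJ
    -- Membership of `J ⊓ ω` in `C_ℓ` excludes the default value `0` of `splitVertex`.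
    have hω : h ℓ (splitVertex C hC V ω (meet e J)) = insertAway p (g ℓ ω) (meet e J) := by
      rw [splitVertex, if_neg hm.ne_empty, dif_pos (hτ.1 hm), hg]
    simp only [splitTree, LTree.val]
    rw [hω, comp_insertAway, insertAway_comp]
    congr 1
    funext i
    split_ifs with hi
    · exact ih i (by simpa [meet] using hi) (hτ.2 i)
    -- The branch is disjoint from `J`: its splitting is `CSp_∅`, and the `P` left at this input of
    -- `ω` is the one that the previous lemma absorbs.
    · have : branchSet e J i = ∅ := by simpa [meet] using hi
      rw [this]
      exact postComp_splitTree_empty hg hp (τ i)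

/-- The tree formula says that splitting along `J` and evaluating is the linear map `μ ↦ μ ∘
P^{⊗n,J}` applied to the value of the original tree. A relation with value `0` thus stays `0`. -/
theorem relVal_splitRel
    (hg : ∀ n (ω : V.obj n) (I : {I // I ∈ C.sets n}),
      h n (splitGen C hC V ω I) = insertAway p (g n ω) I.1)
    (hp : ∀ n (ω : V.obj n), insertAway p (g n ω) ∅ =
      ∑ I ∈ C.sets n, postComp p (insertAway p (g n ω) I))
    {R : ∀ n, Set (LTree V.obj n →₀ k)}
    (hR : ∀ n, ∀ r ∈ R n, relVal (fun m => g m) n r = 0)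
    {n : ℕ} {s : LTree (splitModule C hC V).obj n →₀ k} (hs : s ∈ splitRel C hC V R n) :
    relVal (fun m => h m) n s = 0 := by
  obtain ⟨r, hr, J, hJ, rfl⟩ := hs
  have key : ∀ τ : LTree V.obj n, (splitTree C hC V J τ).val (fun m => h m) =
      insertAwayHom p n J (τ.val fun m => g m) := fun τ =>
    splitTree_val hg hp τ (C.nonempty_of_mem hJ) (hC.meetsIn τ hJ)
  rw [relVal, Finsupp.linearCombination_mapDomain]
  have : LTree.val (fun m => h m) ∘ splitTree C hC V J =
      insertAwayHom p n J ∘ LTree.val (n := n) fun m => g m := funext key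
  rw [this, ← Finsupp.apply_linearCombination]
  exact (congrArg _ (hR n r hr)).trans (map_zero _)

/-! ### Prescribing morphisms by their values on generators -/

/-- The linear map from the multiples of `P` to `Q` that sends `P` to `p`. -/
def spanP (p : Q.obj 1) (n : ℕ) :
    (if n = 1 then (⊤ : Submodule k k) else ⊥ : Submodule k k) →ₗ[k] Q.obj n :=
  if hn : n = 1 then (LinearMap.toSpanSingleton k (Q.obj n) (hn ▸ p)).comp (Submodule.subtype _)
  else 0

/-- Only arity `1` contributes, and its symmetric group is trivial. -/
theorem act_spanP (p : Q.obj 1) {n : ℕ} (σ : Equiv.Perm (Fin n))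
    (c : (if n = 1 then (⊤ : Submodule k k) else ⊥ : Submodule k k)) :
    Q.act n σ (spanP p n c) = spanP p n c := by
  by_cases hn : n = 1
  · subst hn
    rw [Subsingleton.elim σ 1, map_one]
    rfl
  · rw [spanP, dif_neg hn]
    exact map_zero _

variable (V) in
/-- The morphism of `S`-modules `V_P → Q` given by a morphism `V → Q` and the value of `P`. -/
def withPHom (φ : SModule.Hom V Q.toSModule) (p : Q.obj 1) :
    SModule.Hom (withP V) Q.toSModule where
  app n := (φ.app n).coprod (spanP p n)
  map_act n σ y := by
    obtain ⟨y, c⟩ := y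
    change φ.app n (V.act n σ y) + spanP p n c = Q.act n σ (φ.app n y + spanP p n c)
    rw [map_add, φ.map_act, act_spanP]

theorem withPHom_genV (φ : SModule.Hom V Q.toSModule) (p : Q.obj 1) (n : ℕ) (ω : V.obj n) :
    (freeLift (withPHom V φ p)).app n (genV V n ω) = φ.app n ω := by
  change φ.app n ω + spanP p n 0 = _
  rw [map_zero, add_zero]

theorem withPHom_genP (φ : SModule.Hom V Q.toSModule) (p : Q.obj 1) :
    (freeLift (withPHom V φ p)).app 1 (genP V) = p := by
  change φ.app 1 0 + (1 : k) • p = p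
  rw [map_zero, zero_add, one_smul]

open scoped TensorProduct in
theorem splitModule_hom_ext {M : Type*} [AddCommGroup M] [Module k M] {n : ℕ}
    {f f' : (splitModule C hC V).obj n →ₗ[k] M}
    (hf : ∀ ω I, f (splitGen C hC V ω I) = f' (splitGen C hC V ω I)) : f = f' := by
  -- Viewing the maps on the underlying tensor product makes extensionality on the tensors `ω ⊗ e_I`
  -- available.
  let F : V.obj n ⊗[k] ({I // I ∈ C.sets n} →₀ k) →ₗ[k] M := f
  let F' : V.obj n ⊗[k] ({I // I ∈ C.sets n} →₀ k) →ₗ[k] M := f'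
  change F = F'
  refine TensorProduct.ext (LinearMap.ext fun ω => Finsupp.lhom_ext' fun I => ?_)
  exact LinearMap.ext_ring (hf ω I)

/-- The projection is surjective and the free operad is generated by `W`. This gives uniqueness of
the algebra structure. -/
theorem presOperad_hom_ext {W : SModule.{u, v} k} {R : ∀ n, Set (LTree W.obj n →₀ k)}
    {f f' : SOperad.Hom (presOperad W R) Q}
    (hf : ∀ n, (f.app n).comp (((presProj W R).app n).comp (freeGen W n)) =
      (f'.app n).comp (((presProj W R).app n).comp (freeGen W n))) : f = f' := by
  let φ : SModule.Hom W Q.toSModule :=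
    { app := fun n => (f.app n).comp (((presProj W R).app n).comp (freeGen W n))
      map_act := fun n σ y => by
        simp only [LinearMap.comp_apply, freeGen_act, SOperad.Hom.map_act] }
  refine SOperad.Hom.ext_of_proj ?_
  exact (freeLift_unique φ _ fun n y => rfl).trans
    (freeLift_unique φ _ fun n y => (LinearMap.congr_fun (hf n) y).symm).symm

end Main

/-! ### The morphism induced by `ξ`, and algebras with a Rota–Baxter operator -/

section Universal

variable {k : Type u} [CommRing k] (C : Configuration) (hC : C.SInvariant) (V : SModule.{u, v} k)
  (R : ∀ n, Set (LTree V.obj n →₀ k))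

/-- In `CRB(P)` both the Rota–Baxter relations and `R` hold by construction, so the tree computation
applies to the classes of `P` and of the generators. -/
theorem xi_relations {n : ℕ} {y : (freeOperad (splitModule C hC V)).obj n}
    (hy : y ∈ relations (splitModule C hC V) (splitRel C hC V R) n) :
    ((freeLift (xi C hC V)).trans (rbProj C V R)).app n y = 0 := by
  obtain ⟨s, hs, rfl⟩ := hy
  rw [SOperad.Hom.map_relVal]
  refine relVal_splitRel (p := (rbProj C V R).app 1 (genP V))
    (g := fun n => ((rbProj C V R).app n).comp (genV V n))
    (h := fun n => ((rbProj C V R).app n).comp ((xi C hC V).app n)) ?_ ?_ ?_ hs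
  · intro n ω I
    rw [LinearMap.comp_apply, xi_splitGen, SOperad.Hom.map_insertAway]
    rfl
  · intro n ω
    have := SOperad.proj_eq_zero (R := rbRelations C V R) (n := n)
      (Set.mem_union_right _ (Set.mem_range_self ω))
    rw [map_sub, map_sum, sub_eq_zero] at this
    simp only [SOperad.Hom.map_postComp, SOperad.Hom.map_insertAway] at this
    exact this
  · intro n r hr
    refine (SOperad.Hom.map_relVal (rbProj C V R) (fun m y => genV V m y) r).symm.trans ?_
    exact SOperad.proj_eq_zero (Set.mem_union_left _ ⟨r, hr, rfl⟩)

/-- The morphism `CSp(P) → CRB(P)` induced by `ξ`. -/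
def splitToRB : SOperad.Hom (splitOperad C hC V R) (rbOperad C V R) :=
  ((freeLift (xi C hC V)).trans (rbProj C V R)).descend fun _ _ hy => xi_relations C hC V R hy

variable {C V R} {A : Type w} [AddCommGroup A] [Module k A]

/-- The morphism of `S`-modules underlying a `T(V)/(R)`-algebra structure. -/
def algebraHom (α : SOperad.Hom (presOperad V R) (endOperad k A)) :
    SModule.Hom V (endOperad k A).toSModule where
  app n := (α.app n).comp (((presProj V R).app n).comp (freeGen V n))
  map_act n σ y := by
    simp only [LinearMap.comp_apply, freeGen_act, SOperad.Hom.map_act]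

/-- A linear map as a unary operation. -/
def unaryOp (P : A →ₗ[k] A) : (endOperad k A).obj 1 :=
  MultilinearMap.ofSubsingleton k A A (0 : Fin 1) P

theorem insertAway_unaryOp_apply (P : A →ₗ[k] A) {n : ℕ}
    (μ : MultilinearMap k (fun _ : Fin n => A) A) (I : Finset (Fin n)) (y : Fin n → A) :
    (show MultilinearMap k (fun _ : Fin n => A) A from
      insertAway (Q := endOperad k A) (unaryOp P) μ I) y = μ (applyAway P I y) := by
  refine congrArg μ (funext fun i => ?_)
  simp only [applyAway]
  split_ifs <;> rfl

/-- Sending `P` to the operator kills the relations of `CRB(P)`: those of `R` because `A` is an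
algebra over `T(V)/(R)`, the others because, evaluated on a tuple, they are the identity defining a
Rota–Baxter operator. -/
theorem rbRelations_algebra {α : SOperad.Hom (presOperad V R) (endOperad k A)} {P : A →ₗ[k] A}
    (hP : IsRotaBaxter C α P) {n : ℕ} {y : (freeOperad (withP V)).obj n}
    (hy : y ∈ rbRelations C V R n) :
    (freeLift (withPHom V (algebraHom α) (unaryOp P))).app n y = 0 := by
  obtain ⟨r, hr, rfl⟩ | ⟨ω, rfl⟩ := hy
  · rw [SOperad.Hom.map_relVal]
    simp only [withPHom_genV]
    -- The value of `r` on the operations of `A` is the image of `r` under `T(V) → T(V)/(R) →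
    -- End_A`, and the first arrow already kills it.
    refine (SOperad.Hom.map_relVal ((presProj V R).trans α)
      (fun m y => freeGen V m y) r).symm.trans ?_
    exact (congrArg (α.app n) (SOperad.proj_eq_zero ⟨r, hr, rfl⟩)).trans (map_zero _)
  · dsimp only
    rw [map_sub, map_sum, sub_eq_zero]
    simp only [SOperad.Hom.map_postComp, SOperad.Hom.map_insertAway, withPHom_genV,
      withPHom_genP]
    refine MultilinearMap.ext fun y => ?_
    refine (insertAway_unaryOp_apply P _ ∅ y).trans ?_
    refine Eq.trans ?_ ((hP n ω y).trans ?_)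
    · refine congrArg (operation α ω) (funext fun i => ?_)
      simp [applyAway]
    · rw [map_sum]
      refine Eq.trans ?_ (_root_.sum_apply (F := MultilinearMap k (fun _ : Fin n => A) A) _ _ y).symm
      refine Finset.sum_congr rfl fun I _ => ?_
      exact congrArg P (insertAway_unaryOp_apply P _ I y).symm

/-- The `CRB(P)`-algebra given by a `P`-algebra with a Rota-Baxter operator. -/
def rbAlgebra {α : SOperad.Hom (presOperad V R) (endOperad k A)} {P : A →ₗ[k] A}
    (hP : IsRotaBaxter C α P) : SOperad.Hom (rbOperad C V R) (endOperad k A) :=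
  (freeLift (withPHom V (algebraHom α) (unaryOp P))).descend fun _ _ hy =>
    rbRelations_algebra hP hy

theorem operation_splitToRB_rbAlgebra {α : SOperad.Hom (presOperad V R) (endOperad k A)}
    {P : A →ₗ[k] A} (hP : IsRotaBaxter C α P) {n : ℕ} (ω : V.obj n) (I : {I // I ∈ C.sets n})
    (y : Fin n → A) :
    operation ((splitToRB C hC V R).trans (rbAlgebra hP)) (splitGen C hC V ω I) y =
      operation α ω (applyAway P I.1 y) := by
  have : operation ((splitToRB C hC V R).trans (rbAlgebra hP)) (splitGen C hC V ω I) =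
      (freeLift (withPHom V (algebraHom α) (unaryOp P))).app n
        ((xi C hC V).app n (splitGen C hC V ω I)) := rfl
  rw [this, xi_splitGen, SOperad.Hom.map_insertAway, withPHom_genV, withPHom_genP]
  exact insertAway_unaryOp_apply P _ I.1 y

end Universal

end OperadSplitting

end

theorem theorem5p5 {k : Type u} [CommRing k] (C : Configuration) (hC : C.SInvariant)
    (V : SModule.{u, v} k) (hV : ∀ n < 2, Subsingleton (V.obj n))
    (R : ∀ n, Set (LTree V.obj n →₀ k)) :
    (∃! Φ : SOperad.Hom (splitOperad C hC V R) (rbOperad C V R),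
      (presProj (splitModule C hC V) (splitRel C hC V R)).trans Φ =
        (freeLift (xi C hC V)).trans (rbProj C V R)) ∧
    ∀ (A : Type w) [AddCommGroup A] [Module k A]
      (α : SOperad.Hom (presOperad V R) (endOperad k A)) (P : A →ₗ[k] A),
      IsRotaBaxter C α P →
      ∃! β : SOperad.Hom (splitOperad C hC V R) (endOperad k A),
        ∀ (n : ℕ) (ω : V.obj n) (I : {I // I ∈ C.sets n}) (x : Fin n → A),
          operation β (splitGen C hC V ω I) x = operation α ω (applyAway P I.1 x) := by
  -- The triangle commutes by the construction of the descended morphism; uniqueness is surjectivity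
  -- of the projection.
  refine ⟨⟨splitToRB C hC V R, rfl, fun Φ hΦ => SOperad.Hom.ext_of_proj hΦ⟩, ?_⟩
  intro A _ _ α P hP
  refine ⟨(splitToRB C hC V R).trans (rbAlgebra hP),
    fun n ω I y => operation_splitToRB_rbAlgebra hC hP ω I y, fun β hβ => ?_⟩
  refine presOperad_hom_ext fun n => splitModule_hom_ext fun ω I => ?_
  exact MultilinearMap.ext fun y =>
    (hβ n ω I y).trans (operation_splitToRB_rbAlgebra hC hP ω I y).symm
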